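/- Let $\mathbb{K}$ be any field and let $G$ be a simple graph with vertex set $V$, $|V| = 4$. Let $S=\mathbb{K}[x_i,y_i : i\in V]$ with the standard grading $\deg x_i=\deg y_i=1$, and let $\mathcal{I}_G=(x_ix_j-y_iy_j : \{i,j\}\in E(G))\subset S$ be the parity binomial edge ideal of $G$. Write $\beta_{i,j}(S/\mathcal{I}_G)$ for the graded Betti numbers of $S/\mathcal{I}_G$, i.e. the number of summands $S(-j)$ in homological degree $i$ of its minimal graded free resolution over $S$. One says that $S/\mathcal{I}_G$ has a pure resolution if for every $1\le i\le \operatorname{pd}(S/\mathcal{I}_G)$ there is a unique $d_i>0$ with $\beta_{i,d_i}(S/\mathcal{I}_G)\neq 0$. Suppose that one of the following holds: 1. $G$ is a diamond graph (a graph with $4$ vertices and $5$ edges); 2. $G=K_4$ is the complete graph; 3. $G$ is obtained by attaching a pendant edge to a vertex of a triangle $K_3$. Then $\beta_{3,5}(S/\mathcal{I}_G)\neq 0$ and $\beta_{3,6}(S/\mathcal{I}_G)\neq 0$, and $S/\mathcal{I}_G$ does not have a pure resolution. -/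

import Mathlib

/-! ### Graded Betti numbers over a standard graded polynomial ring -/

/-- The component of degree `e` (an integer) of the standard graded polynomial ring `K[σ]`; it is
zero for negative `e`. -/
noncomputable def polyComponent (σ K : Type*) [Field K] (e : ℤ) :
    Submodule K (MvPolynomial σ K) :=
  if 0 ≤ e then MvPolynomial.homogeneousSubmodule σ K e.toNat else ⊥

/-- `v` is a homogeneous element of degree `j` of the graded free module `⨁ᵣ S(-a r)`, whose `r`-th
basis vector has degree `a r`. -/
def IsHomogeneousVec {σ K : Type*} [Field K] {n : ℕ} (a : Fin n → ℤ) (j : ℤ)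
    (v : Fin n → MvPolynomial σ K) : Prop :=
  ∀ r, v r ∈ polyComponent σ K (j - a r)

/-- A minimal graded free resolution
`⋯ → F₂ → F₁ → F₀ → M → 0`, by graded free modules of finite rank, of a module `M` over
`S = K[σ]` with homogeneous components `ℳ j`, `j ∈ ℤ`. Here `Fᵢ = ⨁ᵣ S(-deg i r)`, all maps are
homogeneous of degree zero, and minimality is `d(Fᵢ₊₁) ⊆ 𝔪 Fᵢ` with `𝔪` the ideal generated by the
variables. (For finitely many variables, such a resolution automatically has finite length.) -/
structure MinimalGradedFreeResolution (σ K : Type*) {M : Type*} [Field K] [AddCommGroup M]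
    [Module (MvPolynomial σ K) M] (ℳ : ℤ → AddSubgroup M) where
  /-- the rank of `Fᵢ` -/
  rank : ℕ → ℕ
  /-- the degrees of the basis vectors of `Fᵢ` -/
  deg : ∀ i, Fin (rank i) → ℤ
  /-- the differential `Fᵢ₊₁ → Fᵢ` -/
  d : ∀ i, (Fin (rank (i + 1)) → MvPolynomial σ K) →ₗ[MvPolynomial σ K]
    (Fin (rank i) → MvPolynomial σ K)
  /-- the augmentation `F₀ → M` -/
  ε : (Fin (rank 0) → MvPolynomial σ K) →ₗ[MvPolynomial σ K] M
  d_homogeneous : ∀ i j v, IsHomogeneousVec (deg (i + 1)) j v → IsHomogeneousVec (deg i) j (d i v)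
  ε_homogeneous : ∀ j v, IsHomogeneousVec (deg 0) j v → ε v ∈ ℳ j
  ε_surjective : Function.Surjective ε
  exact_zero : Function.Exact (d 0) ε
  exact_succ : ∀ i, Function.Exact (d (i + 1)) (d i)
  minimal : ∀ i v r, d i v r ∈ MvPolynomial.idealOfVars σ K

/-- The number of summands `S(-j)` in the `i`-th module of the resolution. -/
def MinimalGradedFreeResolution.betti {σ K M : Type*} [Field K] [AddCommGroup M]
    [Module (MvPolynomial σ K) M] {ℳ : ℤ → AddSubgroup M}
    (F : MinimalGradedFreeResolution σ K ℳ) (i : ℕ) (j : ℤ) : ℕ :=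
  (Finset.univ.filter fun r : Fin (F.rank i) => F.deg i r = j).card

open Classical in
/-- The graded Betti number `β_{i,j}(M)`: the number of summands `S(-j)` in homological degree `i`
of the minimal graded free resolution of `M` (which is unique up to isomorphism). -/
noncomputable def gradedBetti (σ K : Type*) {M : Type*} [Field K] [AddCommGroup M]
    [Module (MvPolynomial σ K) M] (ℳ : ℤ → AddSubgroup M) (i : ℕ) (j : ℤ) : ℕ :=
  if h : Nonempty (MinimalGradedFreeResolution σ K ℳ) then h.some.betti i j else 0

/-- The homogeneous component of degree `j` of `S ⧸ I` (a grading if `I` is homogeneous): the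
classes of the homogeneous polynomials of degree `j`. -/
noncomputable def quotientComponent {σ K : Type*} [Field K] (I : Ideal (MvPolynomial σ K)) (j : ℤ) :
    AddSubgroup (MvPolynomial σ K ⧸ I) :=
  (polyComponent σ K j).toAddSubgroup.map (Ideal.Quotient.mk I).toAddMonoidHom

/-- `β_{i,j}(S ⧸ I)` for a homogeneous ideal `I` of the polynomial ring `S = K[σ]`. -/
noncomputable def quotientBetti {σ K : Type*} [Field K] (I : Ideal (MvPolynomial σ K))
    (i : ℕ) (j : ℤ) : ℕ :=
  gradedBetti σ K (quotientComponent I) i j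

/-- The projective dimension of `S ⧸ I` for a homogeneous ideal `I`: the length of the minimal
graded free resolution, that is, the largest `i` with `β_{i,j}(S ⧸ I) ≠ 0` for some `j`. -/
noncomputable def quotientPd {σ K : Type*} [Field K] (I : Ideal (MvPolynomial σ K)) : ℕ∞ :=
  ⨆ (i : ℕ) (_ : ∃ j : ℤ, quotientBetti I i j ≠ 0), (i : ℕ∞)

/-- `S ⧸ I` has a pure resolution: for each `1 ≤ i ≤ pd (S ⧸ I)` there is a unique `dᵢ > 0` with
`β_{i,dᵢ}(S ⧸ I) ≠ 0`. (The case `i = 1` says that the minimal generators of `I` have the same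
degree.) -/
def HasPureResolution {σ K : Type*} [Field K] (I : Ideal (MvPolynomial σ K)) : Prop :=
  ∀ i : ℕ, 1 ≤ i → (i : ℕ∞) ≤ quotientPd I → ∃! j : ℤ, 0 < j ∧ quotientBetti I i j ≠ 0

/-! ### Graphs and parity binomial edge ideals -/

/-- The parity binomial edge ideal `(xᵢ xⱼ - yᵢ yⱼ : {i, j} ∈ E(G))` of `G`, in the polynomial ring
with variables `xᵢ = X (Sum.inl i)` and `yᵢ = X (Sum.inr i)`, for `i` a vertex. -/
noncomputable def parityBinomialEdgeIdeal (K : Type*) [Field K] {V : Type*} (G : SimpleGraph V) :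
    Ideal (MvPolynomial (V ⊕ V) K) :=
  Ideal.span {f | ∃ i j : V, G.Adj i j ∧
    f = MvPolynomial.X (Sum.inl i) * MvPolynomial.X (Sum.inl j)
      - MvPolynomial.X (Sum.inr i) * MvPolynomial.X (Sum.inr j)}

/-- A diamond graph: a graph with 4 vertices and 5 edges. -/
def IsDiamond {V : Type*} (G : SimpleGraph V) : Prop :=
  Nat.card V = 4 ∧ G.edgeSet.ncard = 5

/-- The graph obtained from a triangle `a, b, c` by attaching an edge `{c, v}` to its vertex `c`. -/
def IsTriangleWithPendantEdge {V : Type*} (G : SimpleGraph V) : Prop :=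
  ∃ a b c v : V, [a, b, c, v].Nodup ∧ (∀ w : V, w ∈ [a, b, c, v]) ∧
    G.edgeSet = {s(a, b), s(a, c), s(b, c), s(c, v)}

/-! In each of the three cases `G` contains a triangle `a, b, c` and a fourth vertex `v` adjacent to
`c`. The claw at `c` forces a third syzygy of degree 5 and the triangle forces one of degree 6; two
degrees in homological degree 3 rule out purity. Both facts are proved for an arbitrary minimal
graded free resolution, so the existence of one suffices and its uniqueness is never used.

Degree 5 (`exists_deg_three_eq_five`): linearly independent forms in the span of the edge binomials
have no linear syzygies (`eq_zero_of_linear_syzygy`), so the second and third syzygies start in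
degrees at least 4 and 5. The three binomials at `c` have Koszul syzygies and a syzygy whose
coefficients are 2×2 minors in the variables at `a, b, v`. These four satisfy a linear relation. If
no generator of degree 5 existed in step three, this relation would be trivial, which forces an edge
binomial to vanish.

Degree 6 (`exists_deg_three_eq_six`): a linear specialization to three variables sends the triangle
binomials to a regular sequence and the whole ideal into the ideal they generate. The Koszul complex
of the binomials maps to the resolution, which maps to the Koszul complex of the specialized
sequence. The composite is homotopic to specialization, so in degree three it is 1 modulo the
sequence. The top Koszul generator, of degree 6, therefore cannot map into the maximal ideal times
the third free module. -/

/-! ### Homogeneous parts in graded free modules -/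

section GradedFreeModules

open MvPolynomial

variable {σ K : Type*} [Field K]

lemma mem_polyComponent_iff {e : ℤ} {p : MvPolynomial σ K} :
    p ∈ polyComponent σ K e ↔ ∀ m, coeff m p ≠ 0 → (m.degree : ℤ) = e := by
  unfold polyComponent
  split_ifs with h
  · rw [mem_homogeneousSubmodule]
    constructor
    · intro hp m hm
      have := hp.degree_eq_sum_deg_support (mem_support_iff.2 hm)
      have h2 : m.degree = e.toNat := by rw [Finsupp.degree]; exact this.symm
      omega
    · intro hp m hm
      have := hp m hm
      have h3 : m.degree = Finsupp.weight 1 m :=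
        DFunLike.congr_fun (Finsupp.degree_eq_weight_one (R := ℕ)) m
      omega
  · rw [Submodule.mem_bot]
    constructor
    · rintro rfl m hm
      simp at hm
    · intro hp
      ext m
      by_contra hm
      have := hp m (by simpa using hm)
      omega

lemma MvPolynomial.IsHomogeneous.mem_polyComponent {n : ℕ} {p : MvPolynomial σ K}
    (hp : MvPolynomial.IsHomogeneous p n) : p ∈ polyComponent σ K n := by
  simpa [polyComponent] using hp

lemma mul_mem_polyComponent {d e : ℤ} {p q : MvPolynomial σ K} (hp : p ∈ polyComponent σ K d)
    (hq : q ∈ polyComponent σ K e) : p * q ∈ polyComponent σ K (d + e) := by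
  classical
  rw [mem_polyComponent_iff] at *
  intro m hm
  rw [coeff_mul] at hm
  obtain ⟨⟨x, y⟩, hxy, hne⟩ := Finset.exists_ne_zero_of_sum_ne_zero hm
  rw [← hp x (left_ne_zero_of_mul hne), ← hq y (right_ne_zero_of_mul hne),
    ← show x + y = m by simpa using hxy]
  simp

lemma eq_zero_of_mem_polyComponent_of_neg {e : ℤ} {p : MvPolynomial σ K}
    (hp : p ∈ polyComponent σ K e) (he : e < 0) : p = 0 := by
  simpa [polyComponent, he.not_ge] using hp

lemma eq_C_of_mem_polyComponent_zero {p : MvPolynomial σ K}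
    (hp : p ∈ polyComponent σ K 0) : p = C (constantCoeff p) := by
  classical
  rw [mem_polyComponent_iff] at hp
  ext m
  rw [coeff_C, constantCoeff_eq]
  split_ifs with h
  · rw [h]
  · by_contra hm
    have := hp m hm
    exact h (((Finsupp.degree_eq_zero_iff m).1 (by exact_mod_cast this)).symm)

lemma eq_zero_of_mem_polyComponent_of_ne {d e : ℤ} {p : MvPolynomial σ K}
    (hp : p ∈ polyComponent σ K d) (hq : p ∈ polyComponent σ K e) (h : d ≠ e) : p = 0 := by
  rw [mem_polyComponent_iff] at *
  ext m
  by_contra hm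
  exact h ((hp m hm).symm.trans (hq m hm))

/-- The form in which minimality of a resolution is used throughout: entries of differentials have
no constant term. -/
lemma mem_idealOfVars_iff_constantCoeff {p : MvPolynomial σ K} :
    p ∈ idealOfVars σ K ↔ constantCoeff p = 0 := by
  have := mem_pow_idealOfVars_iff' (R := K) 1 p
  rw [pow_one] at this
  rw [this, constantCoeff_eq]
  constructor
  · intro h
    exact h 0 (by simp)
  · intro h x hx
    rw [(Finsupp.degree_eq_zero_iff x).1 (by omega), h]

lemma constantCoeff_eq_zero_of_mem_polyComponent {e : ℤ} {p : MvPolynomial σ K}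
    (hp : p ∈ polyComponent σ K e) (he : e ≠ 0) : constantCoeff p = 0 := by
  rw [mem_polyComponent_iff] at hp
  by_contra h
  have := hp 0 h
  simp at this
  exact he this.symm

/-- The part of degree `e` of a polynomial. -/
noncomputable def polyPart (e : ℤ) : MvPolynomial σ K →ₗ[K] MvPolynomial σ K :=
  if 0 ≤ e then homogeneousComponent e.toNat else 0

lemma coeff_polyPart (e : ℤ) (p : MvPolynomial σ K) (m : σ →₀ ℕ) [Decidable ((m.degree : ℤ) = e)] :
    coeff m (polyPart e p) = if (m.degree : ℤ) = e then coeff m p else 0 := by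
  unfold polyPart
  split_ifs with h1 h2 h2
  · rw [coeff_homogeneousComponent, if_pos (by omega)]
  · rw [coeff_homogeneousComponent, if_neg (by omega)]
  · omega
  · simp

lemma polyPart_mem (e : ℤ) (p : MvPolynomial σ K) : polyPart e p ∈ polyComponent σ K e := by
  classical
  rw [mem_polyComponent_iff]
  intro m hm
  rw [coeff_polyPart] at hm
  by_contra h
  simp [h] at hm

lemma polyPart_of_mem {e : ℤ} {p : MvPolynomial σ K} (hp : p ∈ polyComponent σ K e) (d : ℤ) :
    polyPart d p = if e = d then p else 0 := by
  classical
  rw [mem_polyComponent_iff] at hp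
  ext m
  rw [coeff_polyPart]
  by_cases hm : coeff m p = 0
  · split_ifs <;> simp [hm]
  · rw [hp m hm]
    split_ifs <;> simp

lemma constantCoeff_polyPart_zero (p : MvPolynomial σ K) :
    constantCoeff (polyPart 0 p) = constantCoeff p := by
  classical
  rw [constantCoeff_eq, coeff_polyPart]
  simp

variable {n m : ℕ}

/-- The part of degree `j` of an element of the graded free module with generators of
degrees `a`. -/
noncomputable def vecPart (a : Fin n → ℤ) (j : ℤ) :
    (Fin n → MvPolynomial σ K) →ₗ[K] (Fin n → MvPolynomial σ K) :=
  LinearMap.pi fun r => (polyPart (j - a r)).comp (LinearMap.proj r)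

@[simp] lemma vecPart_apply (a : Fin n → ℤ) (j : ℤ) (v : Fin n → MvPolynomial σ K) (r : Fin n) :
    vecPart a j v r = polyPart (j - a r) (v r) := rfl

lemma isHomogeneousVec_vecPart (a : Fin n → ℤ) (j : ℤ) (v : Fin n → MvPolynomial σ K) :
    IsHomogeneousVec a j (vecPart a j v) :=
  fun _ => polyPart_mem _ _

lemma IsHomogeneousVec.vecPart_eq {a : Fin n → ℤ} {i : ℤ} {v : Fin n → MvPolynomial σ K}
    (h : IsHomogeneousVec a i v) (j : ℤ) : vecPart a j v = if i = j then v else 0 := by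
  ext1 r
  rw [vecPart_apply, polyPart_of_mem (h r)]
  simp only [sub_left_inj]
  split_ifs <;> rfl

lemma exists_eq_sum_vecPart (a : Fin n → ℤ) (v : Fin n → MvPolynomial σ K) :
    ∃ J : Finset ℤ, v = ∑ j ∈ J, vecPart a j v := by
  classical
  refine ⟨Finset.univ.biUnion fun r => (v r).support.image fun m => (m.degree : ℤ) + a r, ?_⟩
  ext r m
  rw [Finset.sum_apply, coeff_sum]
  simp only [vecPart_apply, coeff_polyPart]
  by_cases hm : coeff m (v r) = 0
  · simp [hm]
  · rw [Finset.sum_eq_single ((m.degree : ℤ) + a r)]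
    · simp
    · intro b _ hb
      rw [if_neg (by omega)]
    · intro h
      exact absurd (Finset.mem_biUnion.2 ⟨r, Finset.mem_univ _,
        Finset.mem_image.2 ⟨m, mem_support_iff.2 hm, rfl⟩⟩) h

/-- By additivity it is enough to check homogeneous vectors, where both sides are the image or zero
according to the degree. -/
lemma vecPart_map {a : Fin n → ℤ} {b : Fin m → ℤ}
    (T : (Fin n → MvPolynomial σ K) →ₗ[MvPolynomial σ K] (Fin m → MvPolynomial σ K))
    (hT : ∀ j v, IsHomogeneousVec a j v → IsHomogeneousVec b j (T v)) (j : ℤ)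
    (v : Fin n → MvPolynomial σ K) : vecPart b j (T v) = T (vecPart a j v) := by
  classical
  obtain ⟨J, hJ⟩ := exists_eq_sum_vecPart a v
  have key : ∀ i, vecPart b j (T (vecPart a i v)) = T (vecPart a j (vecPart a i v)) := by
    intro i
    rw [(hT i _ (isHomogeneousVec_vecPart a i v)).vecPart_eq,
      (isHomogeneousVec_vecPart a i v).vecPart_eq]
    split_ifs <;> simp
  rw [hJ, map_sum, map_sum, map_sum, map_sum]
  exact Finset.sum_congr rfl fun i _ => key i

/-- The degree `j` part of any preimage is again a preimage. All lifts along the resolution can thus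
be chosen with controlled degree. -/
lemma IsHomogeneousVec.exists_preimage {a : Fin n → ℤ} {b : Fin m → ℤ}
    {T : (Fin n → MvPolynomial σ K) →ₗ[MvPolynomial σ K] (Fin m → MvPolynomial σ K)}
    (hT : ∀ j v, IsHomogeneousVec a j v → IsHomogeneousVec b j (T v)) {j : ℤ}
    {w : Fin m → MvPolynomial σ K} (hw : IsHomogeneousVec b j w) (h : ∃ v, T v = w) :
    ∃ v, IsHomogeneousVec a j v ∧ T v = w := by
  obtain ⟨v, rfl⟩ := h
  refine ⟨vecPart a j v, isHomogeneousVec_vecPart _ _ _, ?_⟩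
  rw [← vecPart_map T hT, hw.vecPart_eq, if_pos rfl]

lemma isHomogeneousVec_single (a : Fin n → ℤ) (r : Fin n) :
    IsHomogeneousVec a (a r) (Pi.single r (1 : MvPolynomial σ K)) := by
  intro s
  by_cases h : s = r
  · subst h
    simpa using (isHomogeneous_one σ K).mem_polyComponent
  · simp [h]

lemma IsHomogeneousVec.add {a : Fin n → ℤ} {j : ℤ} {v w : Fin n → MvPolynomial σ K}
    (hv : IsHomogeneousVec a j v) (hw : IsHomogeneousVec a j w) : IsHomogeneousVec a j (v + w) :=
  fun r => add_mem (hv r) (hw r)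

lemma IsHomogeneousVec.sub {a : Fin n → ℤ} {j : ℤ} {v w : Fin n → MvPolynomial σ K}
    (hv : IsHomogeneousVec a j v) (hw : IsHomogeneousVec a j w) : IsHomogeneousVec a j (v - w) :=
  fun r => sub_mem (hv r) (hw r)

lemma IsHomogeneousVec.smul {a : Fin n → ℤ} {d i j : ℤ} {v : Fin n → MvPolynomial σ K}
    (hv : IsHomogeneousVec a i v) {p : MvPolynomial σ K} (hp : p ∈ polyComponent σ K d)
    (h : d + i = j) : IsHomogeneousVec a j (p • v) := by
  intro r
  have := mul_mem_polyComponent hp (hv r)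
  rwa [show d + (i - a r) = j - a r by omega] at this

end GradedFreeModules

/-! ### Existence of minimal graded free resolutions -/

section Existence

open MvPolynomial

variable {σ K : Type*} [Field K] {n : ℕ}

/-- A submodule of a graded free module containing the homogeneous parts of its elements. -/
def IsHomogeneousSubmodule (a : Fin n → ℤ)
    (N : Submodule (MvPolynomial σ K) (Fin n → MvPolynomial σ K)) : Prop :=
  ∀ v ∈ N, ∀ j, vecPart a j v ∈ N

lemma IsHomogeneousSubmodule.exists_generators [Finite σ] {a : Fin n → ℤ}
    {N : Submodule (MvPolynomial σ K) (Fin n → MvPolynomial σ K)}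
    (hN : IsHomogeneousSubmodule a N) :
    ∃ (m : ℕ) (b : Fin m → ℤ) (g : Fin m → Fin n → MvPolynomial σ K),
      (∀ r, IsHomogeneousVec a (b r) (g r)) ∧
        Submodule.span (MvPolynomial σ K) (Set.range g) = N := by
  classical
  set H : Set (Fin n → MvPolynomial σ K) := {v | v ∈ N ∧ ∃ j, IsHomogeneousVec a j v} with hH
  have hspan : Submodule.span (MvPolynomial σ K) H = N := by
    apply le_antisymm
    · exact Submodule.span_le.2 fun v hv => hv.1
    · intro v hv
      obtain ⟨J, hJ⟩ := exists_eq_sum_vecPart a v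
      rw [hJ]
      exact Submodule.sum_mem _ fun j _ =>
        Submodule.subset_span ⟨hN v hv j, j, isHomogeneousVec_vecPart a j v⟩
  have hfg : (Submodule.span (MvPolynomial σ K) H).FG := IsNoetherian.noetherian _
  obtain ⟨s, hsH, hs⟩ := (Submodule.fg_span_iff_fg_span_finset_subset H).1 hfg
  have hdeg : ∀ v : s, ∃ j, IsHomogeneousVec a j (v : Fin n → MvPolynomial σ K) :=
    fun v => (hsH v.2).2
  choose deg hdeg using hdeg
  refine ⟨s.card, fun r => deg (s.equivFin.symm r), fun r => (s.equivFin.symm r).1,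
    fun r => hdeg _, ?_⟩
  rw [← hspan, hs]
  congr 1
  ext v
  constructor
  · rintro ⟨r, rfl⟩
    exact (s.equivFin.symm r).2
  · intro hv
    exact ⟨s.equivFin ⟨v, hv⟩, by simp⟩

lemma isHomogeneousVec_linearCombination {m : ℕ} {a : Fin n → ℤ} {b : Fin m → ℤ}
    {g : Fin m → Fin n → MvPolynomial σ K} (hg : ∀ r, IsHomogeneousVec a (b r) (g r)) (j : ℤ)
    (v : Fin m → MvPolynomial σ K) (hv : IsHomogeneousVec b j v) :
    IsHomogeneousVec a j (Fintype.linearCombination (MvPolynomial σ K) g v) := by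
  intro s
  rw [Fintype.linearCombination_apply, Finset.sum_apply]
  refine sum_mem fun r _ => ?_
  exact (hg r).smul (hv r) (by ring) s

/-- A homogeneous submodule of a graded free module of finite rank has a minimal graded free
cover. -/
lemma IsHomogeneousSubmodule.exists_minimal_cover [Finite σ] {a : Fin n → ℤ}
    {N : Submodule (MvPolynomial σ K) (Fin n → MvPolynomial σ K)}
    (hN : IsHomogeneousSubmodule a N) :
    ∃ (m : ℕ) (b : Fin m → ℤ)
      (d : (Fin m → MvPolynomial σ K) →ₗ[MvPolynomial σ K] (Fin n → MvPolynomial σ K)),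
      (∀ j v, IsHomogeneousVec b j v → IsHomogeneousVec a j (d v)) ∧ LinearMap.range d = N ∧
        IsHomogeneousSubmodule b (LinearMap.ker d) ∧
        ∀ v ∈ LinearMap.ker d, ∀ r, v r ∈ idealOfVars σ K := by
  classical
  have hex := hN.exists_generators
  -- A homogeneous generating family with the fewest members; minimality of the cover comes from
  -- this count.
  obtain ⟨m, ⟨b, g, hg, hspan⟩, hmin⟩ := Nat.findX hex
  have hd := isHomogeneousVec_linearCombination hg
  have hker : IsHomogeneousSubmodule b
      (LinearMap.ker (Fintype.linearCombination (MvPolynomial σ K) g)) := by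
    intro v hv j
    rw [LinearMap.mem_ker] at hv ⊢
    rw [← vecPart_map _ hd, hv, map_zero]
  refine ⟨m, b, Fintype.linearCombination (MvPolynomial σ K) g, hd, ?_, hker, ?_⟩
  · rw [Fintype.range_linearCombination, hspan]
  intro v hv r
  rw [mem_idealOfVars_iff_constantCoeff]
  by_contra hc
  -- In this degree the `r`-th entry of the relation is exactly the nonzero constant term of `v r`,
  -- a unit, so the relation can be solved for `g r`.
  set w := vecPart b (b r) v with hw
  have hwk := hker v hv (b r)
  rw [← hw, LinearMap.mem_ker, Fintype.linearCombination_apply] at hwk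
  have hwr : w r = C (constantCoeff (v r)) := by
    have h0 : w r = polyPart 0 (v r) := by rw [hw, vecPart_apply, sub_self]
    rw [h0, eq_C_of_mem_polyComponent_zero (polyPart_mem 0 (v r)), constantCoeff_polyPart_zero]
  have hmem : g r ∈ Submodule.span (MvPolynomial σ K) (g '' {r}ᶜ) := by
    have hsum := Finset.add_sum_erase Finset.univ (fun i => w i • g i) (Finset.mem_univ r)
    rw [hwk] at hsum
    have h1 : g r = (C (constantCoeff (v r))⁻¹ : MvPolynomial σ K) • (w r • g r) := by
      rw [hwr, smul_smul, ← C_mul, inv_mul_cancel₀ hc, C_1, one_smul]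
    rw [h1, eq_neg_of_add_eq_zero_left hsum]
    refine Submodule.smul_mem _ _ (Submodule.neg_mem _ (Submodule.sum_mem _ fun i hi => ?_))
    exact Submodule.smul_mem _ _ (Submodule.subset_span ⟨i, by simpa using (Finset.mem_erase.1 hi).1,
      rfl⟩)
  have hspan' : Submodule.span (MvPolynomial σ K) (g '' {r}ᶜ) = N := by
    apply le_antisymm
    · rw [← hspan]
      exact Submodule.span_mono (Set.image_subset_range _ _)
    · rw [← hspan, Submodule.span_le]
      rintro _ ⟨i, rfl⟩
      by_cases hi : i = r
      · rw [hi]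
        exact hmem
      · exact Submodule.subset_span ⟨i, hi, rfl⟩
  obtain ⟨k, hk⟩ : ∃ k, m = k + 1 := ⟨m - 1, by have := r.2; omega⟩
  subst hk
  refine hmin k (by omega) ⟨fun i => b (r.succAbove i),
    fun i => g (r.succAbove i), fun i => hg _, ?_⟩
  rw [← hspan', ← Fin.range_succAbove, ← Set.range_comp]
  rfl

/-- A homogeneous submodule of a graded free module `F` that is contained in `𝔪 F`. -/
structure GradedSyzygy (σ K : Type*) [Field K] where
  rank : ℕ
  deg : Fin rank → ℤ
  carrier : Submodule (MvPolynomial σ K) (Fin rank → MvPolynomial σ K)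
  homogeneous : IsHomogeneousSubmodule deg carrier
  minimal : ∀ v ∈ carrier, ∀ r, v r ∈ idealOfVars σ K

lemma GradedSyzygy.exists_next [Finite σ] (X : GradedSyzygy σ K) :
    ∃ (Y : GradedSyzygy σ K) (d : (Fin Y.rank → MvPolynomial σ K) →ₗ[MvPolynomial σ K]
        (Fin X.rank → MvPolynomial σ K)),
      (∀ j v, IsHomogeneousVec Y.deg j v → IsHomogeneousVec X.deg j (d v)) ∧
        LinearMap.range d = X.carrier ∧ LinearMap.ker d = Y.carrier := by
  obtain ⟨m, b, d, h1, h2, h3, h4⟩ := X.homogeneous.exists_minimal_cover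
  exact ⟨⟨m, b, LinearMap.ker d, h3, h4⟩, d, h1, h2, rfl⟩

lemma GradedSyzygy.exists_sequence [Finite σ] (X : GradedSyzygy σ K) :
    ∃ Y : ℕ → GradedSyzygy σ K, Y 0 = X ∧ ∀ i,
      ∃ d : (Fin (Y (i + 1)).rank → MvPolynomial σ K) →ₗ[MvPolynomial σ K]
        (Fin (Y i).rank → MvPolynomial σ K),
      (∀ j v, IsHomogeneousVec (Y (i + 1)).deg j v → IsHomogeneousVec (Y i).deg j (d v)) ∧
        LinearMap.range d = (Y i).carrier ∧ LinearMap.ker d = (Y (i + 1)).carrier := by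
  choose next hnext using GradedSyzygy.exists_next (σ := σ) (K := K)
  exact ⟨fun i => Nat.rec X (fun _ Z => next Z) i, rfl, fun i => hnext _⟩

/-- `S ⧸ I` has a minimal graded free resolution, given by iterated syzygies. -/
lemma nonempty_minimalGradedFreeResolution [Finite σ] {I : Ideal (MvPolynomial σ K)}
    (hI : ∀ p ∈ I, ∀ j, polyPart j p ∈ I) (hI1 : ∀ p ∈ I, p ∈ idealOfVars σ K) :
    Nonempty (MinimalGradedFreeResolution σ K (quotientComponent I)) := by
  let ε : (Fin 1 → MvPolynomial σ K) →ₗ[MvPolynomial σ K] (MvPolynomial σ K ⧸ I) :=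
    (Submodule.mkQ I).comp (LinearMap.proj 0)
  have hε : ∀ v, v ∈ LinearMap.ker ε ↔ v 0 ∈ I := by
    intro v
    rw [LinearMap.mem_ker]
    exact Submodule.Quotient.mk_eq_zero I
  let X : GradedSyzygy σ K :=
    { rank := 1
      deg := fun _ => 0
      carrier := LinearMap.ker ε
      homogeneous := by
        intro v hv j
        rw [hε] at hv ⊢
        exact hI _ hv _
      minimal := by
        intro v hv r
        rw [hε] at hv
        rw [Subsingleton.elim r 0]
        exact hI1 _ hv }
  obtain ⟨Y, hY0, hY⟩ := X.exists_sequence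
  -- The type of the augmentation depends on `Y 0`; bundling it existentially lets it be transported
  -- along `Y 0 = X`.
  have hY0 : ∃ ε : (Fin (Y 0).rank → MvPolynomial σ K) →ₗ[MvPolynomial σ K]
      (MvPolynomial σ K ⧸ I), (∀ j v, IsHomogeneousVec (Y 0).deg j v → ε v ∈ quotientComponent I j)
        ∧ Function.Surjective ε ∧ (Y 0).carrier = LinearMap.ker ε := by
    rw [hY0]
    refine ⟨ε, ?_, ?_, rfl⟩
    · intro j v hv
      refine ⟨v 0, ?_, rfl⟩
      have := hv 0
      change v 0 ∈ polyComponent σ K (j - 0) at this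
      rwa [sub_zero] at this
    · intro q
      obtain ⟨p, rfl⟩ := Submodule.mkQ_surjective I q
      exact ⟨fun _ => p, rfl⟩
  obtain ⟨ε', h1, h2, h3⟩ := hY0
  choose d hd hrange hker using hY
  refine ⟨{ rank := fun i => (Y i).rank
            deg := fun i => (Y i).deg
            d := d
            ε := ε'
            d_homogeneous := hd
            ε_homogeneous := h1
            ε_surjective := h2
            exact_zero := ?_
            exact_succ := ?_
            minimal := ?_ }⟩
  · rw [LinearMap.exact_iff, ← h3]
    exact (hrange 0).symm
  · intro i
    rw [LinearMap.exact_iff]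
    exact (hker i).trans (hrange (i + 1)).symm
  · intro i v r
    exact (Y i).minimal _ (hrange i ▸ LinearMap.mem_range_self (d i) v) r

end Existence

/-! ### Degree bounds in a minimal resolution -/

section ResolutionDegrees

open MvPolynomial

variable {σ K : Type*} [Field K]

namespace MinimalGradedFreeResolution

section Module

variable {M : Type*} [AddCommGroup M] [Module (MvPolynomial σ K) M] {ℳ : ℤ → AddSubgroup M}
  (F : MinimalGradedFreeResolution σ K ℳ)

lemma constantCoeff_eq_zero_of_d_eq_zero {i : ℕ}
    {v : Fin (F.rank (i + 1)) → MvPolynomial σ K} (h : F.d i v = 0) (r : Fin (F.rank (i + 1))) :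
    constantCoeff (v r) = 0 := by
  obtain ⟨w, rfl⟩ := (F.exact_succ i v).1 h
  exact mem_idealOfVars_iff_constantCoeff.1 (F.minimal _ w r)

lemma d_single_ne_zero (i : ℕ) (r : Fin (F.rank (i + 1))) :
    F.d i (Pi.single r 1) ≠ 0 := by
  intro h
  have := F.constantCoeff_eq_zero_of_d_eq_zero h r
  simp at this

lemma d_single_mem (i : ℕ) (r : Fin (F.rank (i + 1))) (s : Fin (F.rank i)) :
    F.d i (Pi.single r 1) s ∈ polyComponent σ K (F.deg (i + 1) r - F.deg i s) :=
  F.d_homogeneous i _ _ (isHomogeneousVec_single _ r) s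

/-- The entry has degree at most 0. Negative degree gives zero, and in degree 0 it is a constant,
which minimality excludes unless it vanishes. -/
lemma d_single_eq_zero_of_le {i : ℕ} {r : Fin (F.rank (i + 1))} {s : Fin (F.rank i)}
    (h : F.deg (i + 1) r ≤ F.deg i s) : F.d i (Pi.single r 1) s = 0 := by
  have hmem := F.d_single_mem i r s
  rcases h.lt_or_eq with h | h
  · exact eq_zero_of_mem_polyComponent_of_neg hmem (by omega)
  · rw [h, sub_self] at hmem
    rw [eq_C_of_mem_polyComponent_zero hmem,
      mem_idealOfVars_iff_constantCoeff.1 (F.minimal _ _ s), C_0]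

/-- Otherwise every entry of the differential at this basis vector would vanish, yet no basis vector
lies in the kernel. -/
lemma add_one_le_deg_succ {i : ℕ} {c : ℤ} (h : ∀ s, c ≤ F.deg i s)
    (r : Fin (F.rank (i + 1))) : c + 1 ≤ F.deg (i + 1) r := by
  by_contra hr
  refine F.d_single_ne_zero i r (funext fun s => F.d_single_eq_zero_of_le ?_)
  have := h s
  omega

lemma exists_homogeneous_lift {i : ℕ} {j : ℤ} {w : Fin (F.rank (i + 1)) → MvPolynomial σ K}
    (hw : IsHomogeneousVec (F.deg (i + 1)) j w) (h : F.d i w = 0) :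
    ∃ v, IsHomogeneousVec (F.deg (i + 2)) j v ∧ F.d (i + 1) v = w :=
  hw.exists_preimage (F.d_homogeneous (i + 1)) ((F.exact_succ i w).1 h)

lemma exists_homogeneous_lift_zero {j : ℤ} {w : Fin (F.rank 0) → MvPolynomial σ K}
    (hw : IsHomogeneousVec (F.deg 0) j w) (h : F.ε w = 0) :
    ∃ v, IsHomogeneousVec (F.deg 1) j v ∧ F.d 0 v = w :=
  hw.exists_preimage (F.d_homogeneous 0) ((F.exact_zero w).1 h)

lemma betti_ne_zero_iff {i : ℕ} {j : ℤ} : F.betti i j ≠ 0 ↔ ∃ r, F.deg i r = j := by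
  rw [betti, Finset.card_ne_zero]
  simp [Finset.Nonempty]

end Module

/-- The zeroth module in the minimal resolution of `S ⧸ I` is `S`. -/
lemma exists_unique_generator {I : Ideal (MvPolynomial σ K)} (hI : I ≠ ⊤)
    (F : MinimalGradedFreeResolution σ K (quotientComponent I)) :
    ∃ r₀ : Fin (F.rank 0), (∀ r, r = r₀) ∧ F.deg 0 r₀ = 0 ∧ ∀ v, F.ε v = 0 ↔ v r₀ ∈ I := by
  classical
  have hker : ∀ v, F.ε v = 0 → ∀ r, constantCoeff (v r) = 0 := by
    intro v hv r
    obtain ⟨w, rfl⟩ := (F.exact_zero v).1 hv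
    exact mem_idealOfVars_iff_constantCoeff.1 (F.minimal _ w r)
  have hgen : ∀ r, ∃ p ∈ polyComponent σ K (F.deg 0 r),
      F.ε (Pi.single r 1) = Ideal.Quotient.mk I p := by
    intro r
    obtain ⟨p, hp, hpe⟩ := F.ε_homogeneous _ _ (isHomogeneousVec_single _ r)
    exact ⟨p, hp, hpe.symm⟩
  choose g hg hgε using hgen
  have hsmul : ∀ (p : MvPolynomial σ K) (x : MvPolynomial σ K),
      p • Ideal.Quotient.mk I x = Ideal.Quotient.mk I (p * x) := fun p x => rfl
  obtain ⟨u, hu⟩ := F.ε_surjective (Ideal.Quotient.mk I 1)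
  -- With `u` a lift of 1, `Pi.single r 1 - g r • u` lies in the kernel and so has no constant
  -- terms. The identity matrix is thus an outer product, which forces its size to be at most one.
  have hdiff : ∀ r s, constantCoeff ((Pi.single r 1 : Fin (F.rank 0) → MvPolynomial σ K) s)
      = constantCoeff (g r) * constantCoeff (u s) := by
    intro r s
    have := hker (Pi.single r 1 - g r • u) (by
      rw [map_sub, map_smul, hu, hgε, hsmul, mul_one, sub_self]) s
    rw [Pi.sub_apply, Pi.smul_apply, smul_eq_mul, map_sub, map_mul, sub_eq_zero] at this
    exact this
  have hone : ∀ r, constantCoeff (g r) * constantCoeff (u r) = 1 := by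
    intro r
    rw [← hdiff]
    simp
  obtain ⟨r₀⟩ : Nonempty (Fin (F.rank 0)) := by
    by_contra hne
    rw [not_nonempty_iff] at hne
    rw [Subsingleton.elim u 0, map_zero] at hu
    exact hI ((Ideal.eq_top_iff_one I).2 (Ideal.Quotient.eq_zero_iff_mem.1 hu.symm))
  have hr₀ : ∀ r, r = r₀ := by
    intro r
    by_contra hne
    have h := hdiff r₀ r
    rw [Pi.single_eq_of_ne hne, map_zero] at h
    rcases mul_eq_zero.1 h.symm with h0 | h0
    · have := hone r₀
      rw [h0, zero_mul] at this
      exact zero_ne_one this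
    · have := hone r
      rw [h0, mul_zero] at this
      exact zero_ne_one this
  have hc : constantCoeff (g r₀) ≠ 0 := left_ne_zero_of_mul_eq_one (hone r₀)
  have hdeg : F.deg 0 r₀ = 0 := by
    by_contra h
    exact hc (constantCoeff_eq_zero_of_mem_polyComponent (hg r₀) h)
  refine ⟨r₀, hr₀, hdeg, fun v => ?_⟩
  have hv : v = v r₀ • Pi.single r₀ 1 := by
    ext1 r
    rw [hr₀ r]
    simp
  have hgC : g r₀ = C (constantCoeff (g r₀)) :=
    eq_C_of_mem_polyComponent_zero (hdeg ▸ hg r₀)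
  have hvε : F.ε v = Ideal.Quotient.mk I (v r₀ * g r₀) := by
    conv_lhs => rw [hv]
    rw [map_smul, hgε, hsmul]
  rw [hvε, Ideal.Quotient.eq_zero_iff_mem, hgC]
  constructor
  · intro h
    have := I.mul_mem_right (C (constantCoeff (g r₀))⁻¹) h
    rwa [mul_assoc, ← C_mul, mul_inv_cancel₀ hc, C_1, mul_one] at this
  · exact fun h => I.mul_mem_right _ h

end MinimalGradedFreeResolution

lemma polyPart_mul_of_mem {d : ℤ} {f : MvPolynomial σ K} (hf : f ∈ polyComponent σ K d) (j : ℤ)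
    (q : MvPolynomial σ K) : polyPart j (q * f) = polyPart (j - d) q * f := by
  induction q using MvPolynomial.induction_on' with
  | monomial u a =>
    have hu : monomial u a ∈ polyComponent σ K (u.degree : ℤ) :=
      (isHomogeneous_monomial a rfl).mem_polyComponent
    rw [polyPart_of_mem hu, polyPart_of_mem (mul_mem_polyComponent hu hf)]
    by_cases h : (u.degree : ℤ) = j - d
    · rw [if_pos h, if_pos (by omega)]
    · rw [if_neg h, if_neg (by omega), zero_mul]
  | add p q hp hq => rw [add_mul, map_add, map_add, hp, hq, add_mul]

lemma polyPart_mem_span {A : Set (MvPolynomial σ K)} {d : ℤ}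
    (hA : ∀ f ∈ A, f ∈ polyComponent σ K d) {p : MvPolynomial σ K} (hp : p ∈ Ideal.span A) (j : ℤ) :
    polyPart j p ∈ Ideal.span A := by
  obtain ⟨n, c, f, rfl⟩ := Submodule.mem_span_set'.1 hp
  rw [map_sum]
  refine Ideal.sum_mem _ fun i _ => ?_
  rw [smul_eq_mul, polyPart_mul_of_mem (hA _ (f i).2)]
  exact Ideal.mul_mem_left _ _ (Ideal.subset_span (f i).2)

/-- Taking degree `d` parts in an ideal combination replaces the coefficients by their constant
terms. -/
lemma mem_span_of_mem_polyComponent {A : Set (MvPolynomial σ K)} {d : ℤ}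
    (hA : ∀ f ∈ A, f ∈ polyComponent σ K d) {p : MvPolynomial σ K} (hp : p ∈ Ideal.span A)
    (hpd : p ∈ polyComponent σ K d) : p ∈ Submodule.span K A := by
  have h := polyPart_of_mem hpd d
  rw [if_pos rfl] at h
  rw [← h]
  obtain ⟨n, c, f, rfl⟩ := Submodule.mem_span_set'.1 hp
  rw [map_sum]
  refine Submodule.sum_mem _ fun i _ => ?_
  rw [smul_eq_mul, polyPart_mul_of_mem (hA _ (f i).2), sub_self,
    eq_C_of_mem_polyComponent_zero (polyPart_mem 0 _), C_mul']
  exact Submodule.smul_mem _ _ (Submodule.subset_span (f i).2)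

lemma eq_zero_of_mem_span_of_lt {A : Set (MvPolynomial σ K)} {d : ℤ}
    (hA : ∀ f ∈ A, f ∈ polyComponent σ K d) {p : MvPolynomial σ K} (hp : p ∈ Ideal.span A)
    {j : ℤ} (hpj : p ∈ polyComponent σ K j) (hj : j < d) : p = 0 := by
  have h := polyPart_of_mem hpj j
  rw [if_pos rfl] at h
  rw [← h]
  obtain ⟨n, c, f, rfl⟩ := Submodule.mem_span_set'.1 hp
  rw [map_sum]
  refine Finset.sum_eq_zero fun i _ => ?_
  rw [smul_eq_mul, polyPart_mul_of_mem (hA _ (f i).2),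
    eq_zero_of_mem_polyComponent_of_neg (polyPart_mem _ _) (by omega), zero_mul]

lemma constantCoeff_eq_zero_of_mem_span {A : Set (MvPolynomial σ K)} {d : ℤ}
    (hA : ∀ f ∈ A, f ∈ polyComponent σ K d) (hd : 0 < d) {p : MvPolynomial σ K}
    (hp : p ∈ Ideal.span A) : constantCoeff p = 0 := by
  rw [← constantCoeff_polyPart_zero,
    eq_zero_of_mem_span_of_lt hA (polyPart_mem_span hA hp 0) (polyPart_mem 0 p) hd, map_zero]

/-- If quadrics generating an ideal have no linear syzygies, then the first syzygies start in degree
two and the second syzygies in degree four. -/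
lemma MinimalGradedFreeResolution.two_le_deg_one_and_four_le_deg_two
    {A : Set (MvPolynomial σ K)} (hA : ∀ f ∈ A, f ∈ polyComponent σ K 2)
    (hlin : ∀ (ι : Type) [Fintype ι] (ℓ q : ι → MvPolynomial σ K),
      (∀ s, ℓ s ∈ polyComponent σ K 1) → (∀ s, q s ∈ Submodule.span K A) →
      LinearIndependent K q → ∑ s, ℓ s * q s = 0 → ∀ s, ℓ s = 0)
    (F : MinimalGradedFreeResolution σ K (quotientComponent (Ideal.span A))) :
    (∀ r, 2 ≤ F.deg 1 r) ∧ ∀ r, 4 ≤ F.deg 2 r := by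
  classical
  have hI : Ideal.span A ≠ ⊤ := by
    rw [Ne, Ideal.eq_top_iff_one]
    intro h
    simpa using constantCoeff_eq_zero_of_mem_span hA (by norm_num) h
  obtain ⟨r₀, hr₀, hdeg, hε⟩ := F.exists_unique_generator hI
  have hq : ∀ s, F.d 0 (Pi.single s 1) r₀ ∈ Ideal.span A := fun s =>
    (hε _).1 ((F.exact_zero _).2 ⟨_, rfl⟩)
  have hqd : ∀ s, F.d 0 (Pi.single s 1) r₀ ∈ polyComponent σ K (F.deg 1 s) := by
    intro s
    have := F.d_single_mem 0 s r₀
    rwa [hdeg, sub_zero] at this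
  have hext : ∀ v w : Fin (F.rank 0) → MvPolynomial σ K, v r₀ = w r₀ → v = w := by
    intro v w h
    ext1 r
    rw [hr₀ r, h]
  have h1 : ∀ r, 2 ≤ F.deg 1 r := by
    intro r
    by_contra hr
    exact F.d_single_ne_zero 0 r
      (hext _ _ (eq_zero_of_mem_span_of_lt hA (hq r) (hqd r) (by omega)))
  refine ⟨h1, fun r => ?_⟩
  have h3 : 2 + 1 ≤ F.deg 2 r := F.add_one_le_deg_succ h1 r
  by_contra hr
  have hr3 : F.deg 2 r = 3 := by omega
  set v := F.d 1 (Pi.single r 1) with hv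
  have hv0 : ∀ s, F.deg 1 s ≠ 2 → v s = 0 := by
    intro s hs
    refine F.d_single_eq_zero_of_le ?_
    have := h1 s
    change F.deg 2 r ≤ _
    omega
  have hsum : ∀ w : Fin (F.rank 1) → MvPolynomial σ K,
      F.d 0 w r₀ = ∑ s, w s * F.d 0 (Pi.single s 1) r₀ := by
    intro w
    conv_lhs => rw [pi_eq_sum_univ' w]
    rw [map_sum, Finset.sum_apply]
    refine Finset.sum_congr rfl fun s _ => ?_
    rw [map_smul, Pi.smul_apply, smul_eq_mul]
  have hdv : F.d 0 v = 0 := (F.exact_succ 0 v).2 ⟨_, rfl⟩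
  refine F.d_single_ne_zero 1 r (funext fun s => ?_)
  by_cases hs : F.deg 1 s = 2
  swap
  · exact hv0 s hs
  -- A second syzygy of degree 3 has linear entries at the generators of degree 2 and zeros
  -- elsewhere, so it is a linear syzygy among quadrics.
  refine hlin {s // F.deg 1 s = 2} (fun s => v s) (fun s => F.d 0 (Pi.single s.1 1) r₀)
    ?_ ?_ ?_ ?_ ⟨s, hs⟩
  · intro s
    have := F.d_single_mem 1 r s.1
    rw [s.2] at this
    change _ ∈ polyComponent σ K (F.deg 2 r - 2) at this
    rwa [hr3] at this
  · intro s
    refine mem_span_of_mem_polyComponent hA (hq s) ?_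
    have := hqd s
    rwa [s.2] at this
  -- A `K`-linear relation among these quadrics is a kernel element with constant entries, and
  -- minimality makes the constants zero.
  · rw [Fintype.linearIndependent_iff]
    intro c hc s
    let w : Fin (F.rank 1) → MvPolynomial σ K :=
      fun t => if h : F.deg 1 t = 2 then C (c ⟨t, h⟩) else 0
    have hw : F.d 0 w = 0 := by
      refine hext _ _ ?_
      rw [hsum, ← Finset.sum_subset (Finset.subset_univ
        (Finset.univ.filter fun t => F.deg 1 t = 2)),
        Finset.sum_subtype (p := fun t => F.deg 1 t = 2) _ (by simp)]
      · rw [Pi.zero_apply, ← hc]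
        refine Finset.sum_congr rfl fun t _ => ?_
        rw [← C_mul', show w t = C (c t) by simp [w, t.2]]
      · intro t _ ht
        rw [show w t = 0 by simpa [w] using fun h => absurd h (by simpa using ht), zero_mul]
    have := F.constantCoeff_eq_zero_of_d_eq_zero hw s
    simpa [w, s.2] using this
  · have := hsum v
    rw [hdv, Pi.zero_apply, ← Finset.sum_subset (Finset.subset_univ
        (Finset.univ.filter fun t => F.deg 1 t = 2)),
        Finset.sum_subtype (p := fun t => F.deg 1 t = 2) _ (by simp)] at this
    · exact this.symm
    · intro t _ ht
      rw [hv0 t (by simpa using ht), zero_mul]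

end ResolutionDegrees

/-! ### Linear syzygies of edge binomials, and claws -/

section EdgeQuadrics

open MvPolynomial

variable {K : Type*} [Field K] {V : Type*}

/-- The binomial `xᵢ xⱼ - yᵢ yⱼ`. -/
noncomputable def parityBinomial (K : Type*) [Field K] {V : Type*} (i j : V) :
    MvPolynomial (V ⊕ V) K :=
  X (Sum.inl i) * X (Sum.inl j) - X (Sum.inr i) * X (Sum.inr j)

/-- The binomials of the edges of a graph. -/
def parityBinomials (K : Type*) [Field K] (G : SimpleGraph V) : Set (MvPolynomial (V ⊕ V) K) :=
  {f | ∃ i j : V, G.Adj i j ∧ f = parityBinomial K i j}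

lemma parityBinomialEdgeIdeal_eq_span (G : SimpleGraph V) :
    parityBinomialEdgeIdeal K G = Ideal.span (parityBinomials K G) := rfl

lemma X_mem_polyComponent (s : V) : (X s : MvPolynomial V K) ∈ polyComponent V K 1 :=
  (isHomogeneous_X K s).mem_polyComponent

lemma X_mul_X_mem_polyComponent (s t : V) :
    (X s * X t : MvPolynomial V K) ∈ polyComponent V K 2 :=
  mul_mem_polyComponent (X_mem_polyComponent s) (X_mem_polyComponent t)

lemma parityBinomial_mem_polyComponent (i j : V) :
    parityBinomial K i j ∈ polyComponent (V ⊕ V) K 2 :=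
  sub_mem (X_mul_X_mem_polyComponent _ _) (X_mul_X_mem_polyComponent _ _)

lemma parityBinomials_subset_polyComponent (G : SimpleGraph V) :
    ∀ f ∈ parityBinomials K G, f ∈ polyComponent (V ⊕ V) K 2 := by
  rintro _ ⟨i, j, -, rfl⟩
  exact parityBinomial_mem_polyComponent i j

lemma eval_parityBinomial (z : V ⊕ V → K) (i j : V) :
    eval z (parityBinomial K i j) =
      z (Sum.inl i) * z (Sum.inl j) - z (Sum.inr i) * z (Sum.inr j) := by
  simp [parityBinomial]

/-- The substitution `x = 0`. -/
noncomputable def killLeft (K : Type*) [Field K] (V : Type*) :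
    MvPolynomial (V ⊕ V) K →ₐ[K] MvPolynomial (V ⊕ V) K :=
  aeval (Sum.elim (fun _ => 0) fun j => X (Sum.inr j))

/-- A combination of the binomials is determined by its part in the `y` variables, since swapping
`x` and `y` recovers the rest up to sign. -/
lemma eq_killLeft_sub_rename_of_mem_span (G : SimpleGraph V) {q : MvPolynomial (V ⊕ V) K}
    (hq : q ∈ Submodule.span K (parityBinomials K G)) :
    q = killLeft K V q - rename Sum.swap (killLeft K V q) := by
  induction hq using Submodule.span_induction with
  | mem f hf =>
    obtain ⟨i, j, -, rfl⟩ := hf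
    simp [parityBinomial, killLeft]
    ring
  | zero => simp
  | add f g _ _ hf hg =>
    conv_lhs => rw [hf, hg]
    simp only [map_add]
    ring
  | smul c f _ hf =>
    conv_lhs => rw [hf]
    rw [map_smul, map_smul, smul_sub]

lemma rename_swap_of_mem_span (G : SimpleGraph V) {q : MvPolynomial (V ⊕ V) K}
    (hq : q ∈ Submodule.span K (parityBinomials K G)) : rename Sum.swap q = -q := by
  induction hq using Submodule.span_induction with
  | mem f hf =>
    obtain ⟨i, j, -, rfl⟩ := hf
    simp [parityBinomial]
  | zero => simp
  | add f g _ _ hf hg => rw [map_add, hf, hg, neg_add]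
  | smul c f _ hf => rw [map_smul, hf, smul_neg]

lemma killLeft_pderiv_of_mem_span (G : SimpleGraph V) {q : MvPolynomial (V ⊕ V) K}
    (hq : q ∈ Submodule.span K (parityBinomials K G)) (k : V) :
    killLeft K V (pderiv (Sum.inl k) q) = 0 := by
  classical
  induction hq using Submodule.span_induction with
  | mem f hf =>
    obtain ⟨i, j, -, rfl⟩ := hf
    simp [parityBinomial, killLeft, pderiv_X]
  | zero => simp
  | add f g _ _ hf hg => rw [map_add, map_add, hf, hg, add_zero]
  | smul c f _ hf => rw [Derivation.map_smul, map_smul, hf, smul_zero]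

lemma pderiv_eq_C_of_mem_polyComponent_one {σ : Type*} {ℓ : MvPolynomial σ K}
    (hℓ : ℓ ∈ polyComponent σ K 1) (k : σ) :
    pderiv k ℓ = C (coeff (Finsupp.single k 1) ℓ) := by
  classical
  have h : ℓ ∈ Submodule.span K (Set.range (X : σ → MvPolynomial σ K)) := by
    rw [← homogeneousSubmodule_one_eq_span_X]
    simpa [polyComponent] using hℓ
  clear hℓ
  induction h using Submodule.span_induction with
  | mem f hf =>
    obtain ⟨i, rfl⟩ := hf
    rw [pderiv_X, coeff_X, Pi.single_apply]
    by_cases hik : i = k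
    · simp [hik]
    · have : ¬ (Finsupp.single i 1 = Finsupp.single k 1) := by
        simpa [Finsupp.single_left_inj] using hik
      simp [hik, this]
  | zero => simp
  | add f g _ _ hf hg => rw [map_add, coeff_add, C_add, hf, hg]
  | smul c f _ hf => rw [Derivation.map_smul, coeff_smul, hf, smul_eq_mul, C_mul, smul_eq_C_mul]

lemma eq_zero_of_mem_polyComponent_one {σ : Type*} {ℓ : MvPolynomial σ K}
    (h : ℓ ∈ polyComponent σ K 1) (h0 : ∀ k, coeff (Finsupp.single k 1) ℓ = 0) : ℓ = 0 := by
  classical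
  ext m
  by_contra hm
  have hdeg := mem_polyComponent_iff.1 h m hm
  obtain ⟨k, hk⟩ : ∃ k, m k ≠ 0 := by
    by_contra hne
    push Not at hne
    rw [show m = 0 from Finsupp.ext hne] at hdeg
    simp at hdeg
  obtain ⟨m', rfl⟩ := le_iff_exists_add.1 (Finsupp.single_le_iff.2 (Nat.one_le_iff_ne_zero.2 hk))
  have hm' : m'.degree = 0 := by
    rw [map_add, Finsupp.degree_single] at hdeg
    omega
  rw [(Finsupp.degree_eq_zero_iff m').1 hm', add_zero] at hm
  exact hm (h0 k)

/-- Differentiate the syzygy by `x_k` and set `x = 0`. The derivatives of the `q s` involve only `x`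
variables and disappear, leaving a constant combination of the `q s` whose `y` part is zero. That
combination is then zero, and independence applies. -/
lemma coeff_inl_eq_zero_of_linear_syzygy (G : SimpleGraph V) {ι : Type*} [Fintype ι]
    {ℓ q : ι → MvPolynomial (V ⊕ V) K} (hℓ : ∀ s, ℓ s ∈ polyComponent (V ⊕ V) K 1)
    (hq : ∀ s, q s ∈ Submodule.span K (parityBinomials K G)) (hind : LinearIndependent K q)
    (h : ∑ s, ℓ s * q s = 0) (k : V) (s : ι) :
    coeff (Finsupp.single (Sum.inl k) 1) (ℓ s) = 0 := by
  have h1 := congrArg (fun p => killLeft K V (pderiv (Sum.inl k) p)) h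
  simp only [map_sum, Derivation.leibniz, smul_eq_mul, map_add, map_mul, map_zero,
    killLeft_pderiv_of_mem_span G (hq _), mul_zero, zero_add,
    pderiv_eq_C_of_mem_polyComponent_one (hℓ _)] at h1
  have h2 : killLeft K V (∑ s, coeff (Finsupp.single (Sum.inl k) 1) (ℓ s) • q s) = 0 := by
    rw [map_sum, ← h1]
    refine Finset.sum_congr rfl fun t _ => ?_
    rw [map_smul, smul_eq_C_mul, mul_comm]
    simp [killLeft]
  have h3 := eq_killLeft_sub_rename_of_mem_span G (Submodule.sum_mem _ fun s _ =>
    Submodule.smul_mem _ (coeff (Finsupp.single (Sum.inl k) 1) (ℓ s)) (hq s) :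
      ∑ s, coeff (Finsupp.single (Sum.inl k) 1) (ℓ s) • q s ∈ _)
  rw [h2, map_zero, sub_zero] at h3
  exact Fintype.linearIndependent_iff.1 hind _ h3 s

lemma eq_zero_of_linear_syzygy (G : SimpleGraph V) {ι : Type*} [Fintype ι]
    {ℓ q : ι → MvPolynomial (V ⊕ V) K} (hℓ : ∀ s, ℓ s ∈ polyComponent (V ⊕ V) K 1)
    (hq : ∀ s, q s ∈ Submodule.span K (parityBinomials K G)) (hind : LinearIndependent K q)
    (h : ∑ s, ℓ s * q s = 0) (s : ι) : ℓ s = 0 := by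
  refine eq_zero_of_mem_polyComponent_one (hℓ s) ?_
  have hinj : Function.Injective (Sum.swap : V ⊕ V → V ⊕ V) :=
    Function.LeftInverse.injective Sum.swap_leftInverse
  rintro (k | k)
  · exact coeff_inl_eq_zero_of_linear_syzygy G hℓ hq hind h k s
  -- Swapping `x` and `y` negates every `q s`, so the swapped linear forms are again a syzygy and
  -- the `y` coefficients reduce to the previous case.
  · have hℓ' : ∀ s, rename Sum.swap (ℓ s) ∈ polyComponent (V ⊕ V) K 1 := by
      intro s
      have := hℓ s
      simp only [polyComponent] at this ⊢
      exact IsHomogeneous.rename_isHomogeneous this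
    have h' : ∑ s, rename Sum.swap (ℓ s) * q s = 0 := by
      have := congrArg (rename Sum.swap) h
      simpa [rename_swap_of_mem_span G (hq _)] using this
    have := coeff_inl_eq_zero_of_linear_syzygy G hℓ' hq hind h' k s
    rwa [← Sum.swap_inr, ← Finsupp.mapDomain_single, coeff_rename_mapDomain _ hinj] at this

lemma IsHomogeneousVec.eq_C {σ : Type*} {n : ℕ} {a : Fin n → ℤ} {j : ℤ}
    {v : Fin n → MvPolynomial σ K} (hv : IsHomogeneousVec a j v) (ha : ∀ r, j ≤ a r) (r : Fin n) :
    v r = C (constantCoeff (v r)) := by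
  rcases (ha r).lt_or_eq with h | h
  · rw [eq_zero_of_mem_polyComponent_of_neg (hv r) (by omega)]
    simp
  · refine eq_C_of_mem_polyComponent_zero ?_
    have := hv r
    rwa [h, sub_self] at this

/-- A claw in `G` gives a third syzygy of degree five. -/
lemma exists_deg_three_eq_five (G : SimpleGraph V) {a b c v : V} (hca : G.Adj c a)
    (hcb : G.Adj c b) (hcv : G.Adj c v) (hab : a ≠ b) (hav : a ≠ v) (hbv : b ≠ v)
    (F : MinimalGradedFreeResolution (V ⊕ V) K (quotientComponent (parityBinomialEdgeIdeal K G))) :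
    ∃ r, F.deg 3 r = 5 := by
  classical
  have hA := parityBinomials_subset_polyComponent (K := K) G
  obtain ⟨hd1, hd2⟩ := F.two_le_deg_one_and_four_le_deg_two hA
    fun ι _ ℓ q h1 h2 h3 h4 => eq_zero_of_linear_syzygy G h1 h2 h3 h4
  have hI : parityBinomialEdgeIdeal K G ≠ ⊤ := by
    rw [Ne, Ideal.eq_top_iff_one]
    intro h
    simpa using constantCoeff_eq_zero_of_mem_span hA (by norm_num) h
  obtain ⟨r₀, hr₀, hdeg, hε⟩ := F.exists_unique_generator hI
  by_contra hne
  push Not at hne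
  have hd3 : ∀ r, 5 < F.deg 3 r := by
    intro r
    have h1 : 4 + 1 ≤ F.deg 3 r := F.add_one_le_deg_succ hd2 r
    have := hne r
    omega
  set u : Fin (F.rank 0) → MvPolynomial (V ⊕ V) K := Pi.single r₀ 1 with hu
  have hu0 : IsHomogeneousVec (F.deg 0) 0 u := by
    rw [← hdeg]
    exact isHomogeneousVec_single _ _
  have hg : ∀ i, G.Adj c i → ∃ g, IsHomogeneousVec (F.deg 1) 2 g ∧
      F.d 0 g = parityBinomial K c i • u := by
    intro i hi
    refine F.exists_homogeneous_lift_zero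
      (hu0.smul (parityBinomial_mem_polyComponent c i) (by norm_num)) ?_
    rw [hε]
    have : parityBinomial K c i ∈ parityBinomialEdgeIdeal K G :=
      Ideal.subset_span ⟨c, i, hi, rfl⟩
    simpa [hu] using this
  obtain ⟨ga, hga, hga'⟩ := hg a hca
  obtain ⟨gb, hgb, hgb'⟩ := hg b hcb
  obtain ⟨gv, hgv, hgv'⟩ := hg v hcv
  have hkos : ∀ (i j : V) (gi gj : Fin (F.rank 1) → MvPolynomial (V ⊕ V) K),
      IsHomogeneousVec (F.deg 1) 2 gi → IsHomogeneousVec (F.deg 1) 2 gj →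
      F.d 0 gi = parityBinomial K c i • u → F.d 0 gj = parityBinomial K c j • u →
      ∃ h, IsHomogeneousVec (F.deg 2) 4 h ∧
        F.d 1 h = parityBinomial K c i • gj - parityBinomial K c j • gi := by
    intro i j gi gj hi hj hi' hj'
    refine F.exists_homogeneous_lift
      ((hj.smul (parityBinomial_mem_polyComponent c i) (by norm_num)).sub
        (hi.smul (parityBinomial_mem_polyComponent c j) (by norm_num))) ?_
    rw [map_sub, map_smul, map_smul, hi', hj', smul_smul, smul_smul, mul_comm, sub_self]
  obtain ⟨hab2, hab2h, hab2d⟩ := hkos a b ga gb hga hgb hga' hgb'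
  obtain ⟨hvb2, hvb2h, hvb2d⟩ := hkos v b gv gb hgv hgb hgv' hgb'
  obtain ⟨hva2, hva2h, hva2d⟩ := hkos v a gv ga hgv hga hgv' hga'
  -- Each binomial at `c` pairs the vector `(x_c, -y_c)` with `(x_i, y_i)`. Three vectors in a rank
  -- two module satisfy the Cramer relation with these minors as coefficients.
  let minor : V → V → MvPolynomial (V ⊕ V) K := fun i j =>
    X (Sum.inl i) * X (Sum.inr j) - X (Sum.inr i) * X (Sum.inl j)
  have hminor : ∀ i j, minor i j ∈ polyComponent (V ⊕ V) K 2 := fun i j =>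
    sub_mem (X_mul_X_mem_polyComponent _ _) (X_mul_X_mem_polyComponent _ _)
  obtain ⟨hs2, hs2h, hs2d⟩ : ∃ h, IsHomogeneousVec (F.deg 2) 4 h ∧
      F.d 1 h = minor a v • gb - minor a b • gv - minor b v • ga := by
    refine F.exists_homogeneous_lift (((hgb.smul (hminor a v) (by norm_num)).sub
      (hgv.smul (hminor a b) (by norm_num))).sub (hga.smul (hminor b v) (by norm_num))) ?_
    rw [map_sub, map_sub, map_smul, map_smul, map_smul, hga', hgb', hgv', smul_smul, smul_smul,
      smul_smul, ← sub_smul, ← sub_smul]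
    have hz : minor a v * parityBinomial K c b - minor a b * parityBinomial K c v
        - minor b v * parityBinomial K c a = 0 := by
      simp only [minor, parityBinomial]
      ring
    rw [hz, zero_smul]
  let x : V ⊕ V → MvPolynomial (V ⊕ V) K := X
  set w : Fin (F.rank 2) → MvPolynomial (V ⊕ V) K :=
    x (Sum.inl c) • hs2 - x (Sum.inr v) • hab2 + x (Sum.inr a) • hvb2 - x (Sum.inr b) • hva2
    with hw
  have hwh : IsHomogeneousVec (F.deg 2) 5 w :=
    (((hs2h.smul (X_mem_polyComponent _) (by norm_num)).sub
      (hab2h.smul (X_mem_polyComponent _) (by norm_num))).add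
      (hvb2h.smul (X_mem_polyComponent _) (by norm_num))).sub
      (hva2h.smul (X_mem_polyComponent _) (by norm_num))
  have hwd : F.d 1 w = 0 := by
    rw [hw, map_sub, map_add, map_sub, map_smul, map_smul, map_smul, map_smul, hs2d, hab2d, hvb2d,
      hva2d]
    ext1 r
    simp only [Pi.sub_apply, Pi.add_apply, Pi.smul_apply, smul_eq_mul, Pi.zero_apply, minor,
      parityBinomial, x]
    ring
  obtain ⟨t, hth, htd⟩ := F.exists_homogeneous_lift hwh hwd
  -- A vector of degree 5 in a module whose generators all have degree above 5.
  have ht : t = 0 := by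
    ext1 r
    refine eq_zero_of_mem_polyComponent_of_neg (hth r) ?_
    have : 5 < F.deg (1 + 2) r := hd3 r
    omega
  rw [ht, map_zero] at htd
  have hab0 : hab2 = 0 := by
    ext1 r
    have hr := congrFun htd.symm r
    simp only [hw, Pi.sub_apply, Pi.add_apply, Pi.smul_apply, smul_eq_mul, Pi.zero_apply, x] at hr
    rw [IsHomogeneousVec.eq_C hs2h hd2 r,
      IsHomogeneousVec.eq_C hab2h hd2 r,
      IsHomogeneousVec.eq_C hvb2h hd2 r,
      IsHomogeneousVec.eq_C hva2h hd2 r] at hr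
    -- The four syzygies have constant entries, being of the lowest possible degree; this point
    -- isolates the coefficient of `y_v`.
    have hr' := congrArg (eval fun s => if s = Sum.inr v then (1 : K) else 0) hr
    simp [hav, hbv] at hr'
    rw [IsHomogeneousVec.eq_C hab2h hd2 r, hr']
    simp
  rw [hab0, map_zero] at hab2d
  have hgb0 : gb = 0 := by
    ext1 r
    have hr := congrFun hab2d.symm r
    simp only [Pi.sub_apply, Pi.smul_apply, smul_eq_mul, Pi.zero_apply] at hr
    rw [IsHomogeneousVec.eq_C hga hd1 r,
      IsHomogeneousVec.eq_C hgb hd1 r] at hr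
    -- At this point the binomial of `c, a` is 1 and that of `c, b` is 0.
    have hr' := congrArg (eval fun s =>
      if s = Sum.inl a ∨ s = Sum.inl c then (1 : K) else 0) hr
    simp [eval_parityBinomial, hab.symm, hcb.ne.symm] at hr'
    rw [IsHomogeneousVec.eq_C hgb hd1 r, hr']
    simp
  rw [hgb0, map_zero] at hgb'
  have hr := congrFun hgb'.symm r₀
  simp only [hu, Pi.smul_apply, Pi.single_eq_same, smul_eq_mul, mul_one, Pi.zero_apply] at hr
  have hr' := congrArg (eval fun s =>
      if s = Sum.inl b ∨ s = Sum.inl c then (1 : K) else 0) hr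
  simp [eval_parityBinomial] at hr'

end EdgeQuadrics

/-! ### Comparison with a specialized Koszul complex -/

section KoszulComparison

open MvPolynomial

section Exactness

variable {T : Type*} [CommRing T] [IsDomain T] {f₁ f₂ f₃ : T}

/-- Exactness of the Koszul complex of a regular sequence in degree one. -/
lemma koszul_exact_one (h0 : f₁ ≠ 0) (h1 : ∀ p q, p * f₁ + q * f₂ = 0 → f₁ ∣ q)
    (h2 : ∀ c x y, c * f₃ = x * f₁ + y * f₂ → ∃ x y, c = x * f₁ + y * f₂) {a b c : T}
    (h : a * f₁ + b * f₂ + c * f₃ = 0) :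
    ∃ m₁₂ m₁₃ m₂₃, a = -(m₁₂ * f₂) - m₁₃ * f₃ ∧ b = m₁₂ * f₁ - m₂₃ * f₃ ∧
      c = m₁₃ * f₁ + m₂₃ * f₂ := by
  obtain ⟨m₁₃, m₂₃, rfl⟩ := h2 c (-a) (-b) (by linear_combination h)
  obtain ⟨m₁₂, hm⟩ := h1 (a + m₁₃ * f₃) (b + m₂₃ * f₃) (by linear_combination h)
  refine ⟨m₁₂, m₁₃, m₂₃, ?_, by linear_combination hm, rfl⟩
  apply mul_right_cancel₀ h0
  linear_combination h - f₂ * hm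

/-- Exactness of the Koszul complex of a regular sequence in degree two. -/
lemma koszul_exact_two (h0 : f₁ ≠ 0) (h1 : ∀ p q, p * f₁ + q * f₂ = 0 → f₁ ∣ q)
    {m₁₂ m₁₃ m₂₃ : T} (hb : m₁₂ * f₁ - m₂₃ * f₃ = 0) (hc : m₁₃ * f₁ + m₂₃ * f₂ = 0) :
    ∃ q, m₁₂ = q * f₃ ∧ m₁₃ = -(q * f₂) ∧ m₂₃ = q * f₁ := by
  obtain ⟨q, rfl⟩ := h1 _ _ hc
  refine ⟨q, ?_, ?_, mul_comm _ _⟩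
  · apply mul_right_cancel₀ h0
    linear_combination hb
  · apply mul_right_cancel₀ h0
    linear_combination hc

end Exactness

section Extension

variable {S T : Type*} [CommRing S] [CommRing T] (ρ : S →+* T) {n m : ℕ}

/-- The semilinear extension of a family of values on the basis of a free module. -/
def semilinExt (A : Fin n → T) (v : Fin n → S) : T := ∑ s, ρ (v s) * A s

lemma semilinExt_add (A : Fin n → T) (v w : Fin n → S) :
    semilinExt ρ A (v + w) = semilinExt ρ A v + semilinExt ρ A w := by
  simp [semilinExt, add_mul, Finset.sum_add_distrib]

lemma semilinExt_sub (A : Fin n → T) (v w : Fin n → S) :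
    semilinExt ρ A (v - w) = semilinExt ρ A v - semilinExt ρ A w := by
  simp [semilinExt, sub_mul, Finset.sum_sub_distrib]

lemma semilinExt_smul (A : Fin n → T) (p : S) (v : Fin n → S) :
    semilinExt ρ A (p • v) = ρ p * semilinExt ρ A v := by
  simp [semilinExt, Finset.mul_sum, mul_assoc]

lemma semilinExt_add_left (A B : Fin n → T) (v : Fin n → S) :
    semilinExt ρ (fun s => A s + B s) v =
      semilinExt ρ A v + semilinExt ρ B v := by
  simp [semilinExt, mul_add, Finset.sum_add_distrib]

lemma semilinExt_sub_left (A B : Fin n → T) (v : Fin n → S) :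
    semilinExt ρ (fun s => A s - B s) v =
      semilinExt ρ A v - semilinExt ρ B v := by
  simp [semilinExt, mul_sub, Finset.sum_sub_distrib]

lemma semilinExt_neg_left (A : Fin n → T) (v : Fin n → S) :
    semilinExt ρ (fun s => -A s) v = -semilinExt ρ A v := by
  simp [semilinExt]

lemma semilinExt_mul_left (A : Fin n → T) (c : T) (v : Fin n → S) :
    semilinExt ρ (fun s => A s * c) v = semilinExt ρ A v * c := by
  simp [semilinExt, Finset.sum_mul, mul_assoc]

/-- Allows a comparison map to be chosen on basis vectors only: its compatibility with a
differential then extends to all vectors. -/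
lemma semilinExt_map (A : Fin n → T) (D : (Fin m → S) →ₗ[S] (Fin n → S))
    (v : Fin m → S) : semilinExt ρ A (D v) =
      semilinExt ρ (fun r => semilinExt ρ A (D (Pi.single r 1))) v := by
  classical
  have h : ∀ s, D v s = ∑ r, v r * D (Pi.single r 1) s := by
    intro s
    conv_lhs => rw [pi_eq_sum_univ' v]
    rw [map_sum, Finset.sum_apply]
    refine Finset.sum_congr rfl fun r _ => ?_
    rw [map_smul, Pi.smul_apply, smul_eq_mul]
  simp only [semilinExt, h, map_sum, map_mul, Finset.sum_mul, Finset.mul_sum, mul_assoc]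
  exact Finset.sum_comm

end Extension

variable {σ K : Type*} [Field K]

/-- If `S ⧸ I` specializes to a complete intersection of three quadrics lying in `I`, then the top
Koszul syzygy of these quadrics gives a third syzygy of degree six of `S ⧸ I`. -/
lemma MinimalGradedFreeResolution.exists_deg_three_eq_six {I : Ideal (MvPolynomial σ K)}
    (hI : I ≠ ⊤) (F : MinimalGradedFreeResolution σ K (quotientComponent I))
    {T k : Type*} [CommRing T] [IsDomain T] [CommRing k] [Nontrivial k]
    (ρ : MvPolynomial σ K →+* T) (χ : T →+* k)
    (hχ : ∀ p : MvPolynomial σ K, constantCoeff p = 0 → χ (ρ p) = 0)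
    {f₁ f₂ f₃ : MvPolynomial σ K} (hf₁ : f₁ ∈ I) (hf₂ : f₂ ∈ I) (hf₃ : f₃ ∈ I)
    (hd₁ : f₁ ∈ polyComponent σ K 2) (hd₂ : f₂ ∈ polyComponent σ K 2)
    (hd₃ : f₃ ∈ polyComponent σ K 2)
    (hρ : ∀ p ∈ I, ∃ a b c, ρ p = a * ρ f₁ + b * ρ f₂ + c * ρ f₃) (h0 : ρ f₁ ≠ 0)
    (h1 : ∀ p q, p * ρ f₁ + q * ρ f₂ = 0 → ρ f₁ ∣ q)
    (h2 : ∀ c x y, c * ρ f₃ = x * ρ f₁ + y * ρ f₂ → ∃ x y, c = x * ρ f₁ + y * ρ f₂) :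
    ∃ r, F.deg 3 r = 6 := by
  classical
  obtain ⟨r₀, hr₀, hdeg, hε⟩ := F.exists_unique_generator hI
  by_contra hne
  push Not at hne
  set u : Fin (F.rank 0) → MvPolynomial σ K := Pi.single r₀ 1 with hu
  have hu0 : IsHomogeneousVec (F.deg 0) 0 u := by
    rw [← hdeg]
    exact isHomogeneousVec_single _ _
  -- the comparison map from the Koszul complex to the resolution
  have hg : ∀ f ∈ I, f ∈ polyComponent σ K 2 → ∃ g, IsHomogeneousVec (F.deg 1) 2 g ∧
      F.d 0 g = f • u := by
    intro f hf hfd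
    refine F.exists_homogeneous_lift_zero (hu0.smul hfd (by norm_num)) ?_
    rw [hε]
    simpa [hu] using hf
  obtain ⟨g₁, hg₁, hg₁d⟩ := hg f₁ hf₁ hd₁
  obtain ⟨g₂, hg₂, hg₂d⟩ := hg f₂ hf₂ hd₂
  obtain ⟨g₃, hg₃, hg₃d⟩ := hg f₃ hf₃ hd₃
  have hkos : ∀ (f f' : MvPolynomial σ K) (g g' : Fin (F.rank 1) → MvPolynomial σ K),
      f ∈ polyComponent σ K 2 → f' ∈ polyComponent σ K 2 →
      IsHomogeneousVec (F.deg 1) 2 g → IsHomogeneousVec (F.deg 1) 2 g' →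
      F.d 0 g = f • u → F.d 0 g' = f' • u →
      ∃ h, IsHomogeneousVec (F.deg 2) 4 h ∧ F.d 1 h = f • g' - f' • g := by
    intro f f' g g' hf hf' hg hg' hgd hgd'
    refine F.exists_homogeneous_lift
      ((hg'.smul hf (by norm_num)).sub (hg.smul hf' (by norm_num))) ?_
    rw [map_sub, map_smul, map_smul, hgd, hgd', smul_smul, smul_smul, mul_comm, sub_self]
  obtain ⟨k₁₂, hk₁₂, hk₁₂d⟩ := hkos f₁ f₂ g₁ g₂ hd₁ hd₂ hg₁ hg₂ hg₁d hg₂d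
  obtain ⟨k₁₃, hk₁₃, hk₁₃d⟩ := hkos f₁ f₃ g₁ g₃ hd₁ hd₃ hg₁ hg₃ hg₁d hg₃d
  obtain ⟨k₂₃, hk₂₃, hk₂₃d⟩ := hkos f₂ f₃ g₂ g₃ hd₂ hd₃ hg₂ hg₃ hg₂d hg₃d
  obtain ⟨w, hwh, hwd⟩ : ∃ w, IsHomogeneousVec (F.deg 3) 6 w ∧
      F.d 2 w = f₁ • k₂₃ - f₂ • k₁₃ + f₃ • k₁₂ := by
    refine F.exists_homogeneous_lift (((hk₂₃.smul hd₁ (by norm_num)).sub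
      (hk₁₃.smul hd₂ (by norm_num))).add (hk₁₂.smul hd₃ (by norm_num))) ?_
    rw [map_add, map_sub, map_smul, map_smul, map_smul, hk₁₂d, hk₁₃d, hk₂₃d]
    ext1 r
    simp only [Pi.sub_apply, Pi.add_apply, Pi.smul_apply, smul_eq_mul, Pi.zero_apply]
    ring
  -- the comparison map from the resolution to the specialized Koszul complex
  set e₁ := ρ f₁
  set e₂ := ρ f₂
  set e₃ := ρ f₃
  have hb1 : ∀ s, ∃ a b c, ρ (F.d 0 (Pi.single s 1) r₀) = a * e₁ + b * e₂ + c * e₃ := fun s =>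
    hρ _ ((hε _).1 ((F.exact_zero _).2 ⟨_, rfl⟩))
  choose A B C hABC using hb1
  have hψ1 : ∀ v, ρ (F.d 0 v r₀) = semilinExt ρ A v * e₁ +
      semilinExt ρ B v * e₂ + semilinExt ρ C v * e₃ := by
    intro v
    have h := semilinExt_map ρ (Pi.single r₀ 1) (F.d 0) v
    have hr : ∀ x : Fin (F.rank 0) → MvPolynomial σ K,
        semilinExt ρ (Pi.single r₀ 1) x = ρ (x r₀) := by
      intro x
      rw [semilinExt, Finset.sum_eq_single r₀]
      · simp
      · exact fun s _ hs => absurd (hr₀ s) hs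
      · simp
    simp only [hr, hABC, semilinExt_add_left, semilinExt_mul_left] at h
    exact h
  have hb2 : ∀ s, ∃ m₁₂ m₁₃ m₂₃, semilinExt ρ A (F.d 1 (Pi.single s 1)) = -(m₁₂ * e₂) - m₁₃ * e₃ ∧
      semilinExt ρ B (F.d 1 (Pi.single s 1)) = m₁₂ * e₁ - m₂₃ * e₃ ∧
      semilinExt ρ C (F.d 1 (Pi.single s 1)) = m₁₃ * e₁ + m₂₃ * e₂ := by
    intro s
    refine koszul_exact_one h0 h1 h2 ?_
    rw [← hψ1, (F.exact_succ 0 _).2 ⟨_, rfl⟩, Pi.zero_apply, map_zero]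
  choose M₁₂ M₁₃ M₂₃ hMA hMB hMC using hb2
  have hψ2A : ∀ v, semilinExt ρ A (F.d 1 v) =
      -(semilinExt ρ M₁₂ v * e₂) - semilinExt ρ M₁₃ v * e₃ := by
    intro v
    rw [semilinExt_map]
    simp only [hMA, semilinExt_sub_left, semilinExt_neg_left,
      semilinExt_mul_left]
  have hψ2B : ∀ v, semilinExt ρ B (F.d 1 v) =
      semilinExt ρ M₁₂ v * e₁ - semilinExt ρ M₂₃ v * e₃ := by
    intro v
    rw [semilinExt_map]
    simp only [hMB, semilinExt_sub_left, semilinExt_mul_left]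
  have hψ2C : ∀ v, semilinExt ρ C (F.d 1 v) =
      semilinExt ρ M₁₃ v * e₁ + semilinExt ρ M₂₃ v * e₂ := by
    intro v
    rw [semilinExt_map]
    simp only [hMC, semilinExt_add_left, semilinExt_mul_left]
  have hLz : ∀ {n : ℕ} (A : Fin n → T), semilinExt ρ A 0 = 0 := by
    intro n A
    simp [semilinExt]
  have hb3 : ∀ s, ∃ q, semilinExt ρ M₁₂ (F.d 2 (Pi.single s 1)) = q * e₃ ∧
      semilinExt ρ M₁₃ (F.d 2 (Pi.single s 1)) = -(q * e₂) ∧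
          semilinExt ρ M₂₃ (F.d 2 (Pi.single s 1)) = q * e₁ := by
    intro s
    have hz : F.d 1 (F.d 2 (Pi.single s 1)) = 0 := (F.exact_succ 1 _).2 ⟨_, rfl⟩
    refine koszul_exact_two h0 h1 ?_ ?_
    · rw [← hψ2B, hz, hLz]
    · rw [← hψ2C, hz, hLz]
  -- Only the `M₂₃` coordinate is kept: it determines `Q`, because `e₁` can be cancelled.
  choose Q _ _ hQ using hb3
  have hψ3 : ∀ v, semilinExt ρ M₂₃ (F.d 2 v) = semilinExt ρ Q v * e₁ := by
    intro v
    rw [semilinExt_map]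
    simp only [hQ, semilinExt_mul_left]
  -- the composite is homotopic to the specialization
  have hψg : ∀ f g, F.d 0 g = f • u → ρ f =
      semilinExt ρ A g * e₁ + semilinExt ρ B g * e₂ + semilinExt ρ C g * e₃ := by
    intro f g h
    rw [← hψ1, h]
    simp [hu]
  -- Null-homotopy in degree one: composite minus specialization is a cycle on each Koszul
  -- generator, hence a boundary.
  obtain ⟨a₁, b₁, c₁, hA₁, hB₁, hC₁⟩ := koszul_exact_one h0 h1 h2
    (show (semilinExt ρ A g₁ - 1) * e₁ + semilinExt ρ B g₁ * e₂ + semilinExt ρ C g₁ * e₃ = 0 by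
      linear_combination -hψg f₁ g₁ hg₁d)
  obtain ⟨a₂, b₂, c₂, hA₂, hB₂, hC₂⟩ := koszul_exact_one h0 h1 h2
    (show semilinExt ρ A g₂ * e₁ + (semilinExt ρ B g₂ - 1) * e₂ + semilinExt ρ C g₂ * e₃ = 0 by
      linear_combination -hψg f₂ g₂ hg₂d)
  obtain ⟨a₃, b₃, c₃, hA₃, hB₃, hC₃⟩ := koszul_exact_one h0 h1 h2
    (show semilinExt ρ A g₃ * e₁ + semilinExt ρ B g₃ * e₂ + (semilinExt ρ C g₃ - 1) * e₃ = 0 by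
      linear_combination -hψg f₃ g₃ hg₃d)
  have hLk : ∀ {n : ℕ} (A : Fin n → T) (f f' : MvPolynomial σ K) (g g' : Fin n → MvPolynomial σ K),
      semilinExt ρ A (f • g' - f' • g) = ρ f * semilinExt ρ A g' - ρ f' * semilinExt ρ A g := by
    intro n A f f' g g'
    simp only [semilinExt_sub, semilinExt_smul]
  have hB₁₂ := hψ2B k₁₂
  have hC₁₂ := hψ2C k₁₂
  have hB₁₃ := hψ2B k₁₃
  have hC₁₃ := hψ2C k₁₃
  have hB₂₃ := hψ2B k₂₃
  have hC₂₃ := hψ2C k₂₃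
  rw [hk₁₂d, hLk] at hB₁₂ hC₁₂
  rw [hk₁₃d, hLk] at hB₁₃ hC₁₃
  rw [hk₂₃d, hLk] at hB₂₃ hC₂₃
  -- Next stage of the homotopy: after subtracting the identity and the degree one correction, the
  -- remainder is a cycle in Koszul degree two.
  obtain ⟨n₁₂, -, -, hn₁₂⟩ := koszul_exact_two (m₁₂ := semilinExt ρ M₁₂ k₁₂ - 1 - e₁ * a₂ + e₂ * a₁)
    (m₁₃ := semilinExt ρ M₁₃ k₁₂ - e₁ * b₂ + e₂ * b₁) (m₂₃ := semilinExt ρ M₂₃ k₁₂ - e₁ * c₂ +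
        e₂ * c₁) (f₃ := e₃) h0 h1
    (by linear_combination e₁ * hB₂ - e₂ * hB₁ - hB₁₂)
    (by linear_combination e₁ * hC₂ - e₂ * hC₁ - hC₁₂)
  obtain ⟨n₁₃, -, -, hn₁₃⟩ := koszul_exact_two (m₁₂ := semilinExt ρ M₁₂ k₁₃ - e₁ * a₃ + e₃ * a₁)
    (m₁₃ := semilinExt ρ M₁₃ k₁₃ - 1 - e₁ * b₃ + e₃ * b₁) (m₂₃ := semilinExt ρ M₂₃ k₁₃ - e₁ * c₃ +
        e₃ * c₁) (f₃ := e₃) h0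
    h1
    (by linear_combination e₁ * hB₃ - e₃ * hB₁ - hB₁₃)
    (by linear_combination e₁ * hC₃ - e₃ * hC₁ - hC₁₃)
  obtain ⟨n₂₃, -, -, hn₂₃⟩ := koszul_exact_two (m₁₂ := semilinExt ρ M₁₂ k₂₃ - e₂ * a₃ + e₃ * a₂)
    (m₁₃ := semilinExt ρ M₁₃ k₂₃ - e₂ * b₃ + e₃ * b₂) (m₂₃ := semilinExt ρ M₂₃ k₂₃ - 1 - e₂ * c₃ +
        e₃ * c₂) (f₃ := e₃) h0
    h1
    (by linear_combination e₂ * hB₃ - e₃ * hB₂ - hB₂₃)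
    (by linear_combination e₂ * hC₃ - e₃ * hC₂ - hC₂₃)
  have hw := hψ3 w
  rw [hwd] at hw
  simp only [semilinExt_add, semilinExt_sub, semilinExt_smul] at hw
  have hQw : semilinExt ρ Q w = 1 + e₁ * n₂₃ - e₂ * n₁₃ + e₃ * n₁₂ := by
    apply mul_right_cancel₀ h0
    linear_combination -hw + e₁ * hn₂₃ - e₂ * hn₁₃ + e₃ * hn₁₂
  have hχf : ∀ f ∈ polyComponent σ K 2, χ (ρ f) = 0 := fun f hf =>
    hχ f (constantCoeff_eq_zero_of_mem_polyComponent hf (by norm_num))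
  have hone : χ (semilinExt ρ Q w) = 1 := by
    rw [hQw]
    simp [e₁, e₂, e₃, hχf f₁ hd₁, hχf f₂ hd₂, hχf f₃ hd₃]
  -- Without a generator of degree 6, every entry of `w` has nonzero degree, so its constant term
  -- vanishes.
  have hzero : χ (semilinExt ρ Q w) = 0 := by
    rw [semilinExt, map_sum]
    refine Finset.sum_eq_zero fun r _ => ?_
    rw [map_mul, hχ (w r) (constantCoeff_eq_zero_of_mem_polyComponent (hwh r)
      (sub_ne_zero.2 (hne r).symm)), zero_mul]
  exact one_ne_zero (hone.symm.trans hzero)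

end KoszulComparison

/-! ### Specializing a triangle to a complete intersection -/

section TriangleSpecialization

open MvPolynomial

variable {K : Type*} [Field K]

lemma X_dvd_sub_aeval_update {σ : Type*} [DecidableEq σ] (i : σ) (p : MvPolynomial σ K) :
    X i ∣ p - aeval (fun j => if j = i then (0 : MvPolynomial σ K) else X j) p := by
  induction p using MvPolynomial.induction_on with
  | C a => simp
  | add p q hp hq =>
    rw [map_add, add_sub_add_comm]
    exact dvd_add hp hq
  | mul_X p j hp =>
    rw [map_mul, aeval_X]
    split_ifs with h
    · subst h
      simp
    · rw [← sub_mul]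
      exact hp.mul_right _

lemma not_X_dvd_X {i j : Fin 3} (h : i ≠ j) :
    ¬ (X i : MvPolynomial (Fin 3) K) ∣ X j := by
  rw [X_dvd_X]
  exact h

/-- The quadric `t (s + t) - (s + u)²`. -/
noncomputable def triangleQuadric (K : Type*) [Field K] : MvPolynomial (Fin 3) K :=
  X 1 * (X 0 + X 1) - (X 0 + X 2) * (X 0 + X 2)

/-- Write `s, t, u` for the variables. Modulo `s` the quadric is `t² - u²`; if `tu` divides `p (t² -
u²)`, then `t` divides `p u²` and `u` divides `p t²`, so `tu` divides `p`. -/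
lemma triangleQuadric_colon {p x y : MvPolynomial (Fin 3) K}
    (h : p * triangleQuadric K = x * (X 1 * X 2) + y * X 0) :
    ∃ x y, p = x * (X 1 * X 2) + y * X 0 := by
  obtain ⟨y', hy'⟩ := X_dvd_sub_aeval_update (0 : Fin 3) p
  set π := aeval (R := K) (fun j : Fin 3 => if j = 0 then (0 : MvPolynomial (Fin 3) K) else X j)
  have h' := congrArg π h
  simp only [triangleQuadric, π, map_mul, map_add, map_sub, aeval_X] at h'
  simp only [if_true, if_neg (show (1 : Fin 3) ≠ 0 by decide),
    if_neg (show (2 : Fin 3) ≠ 0 by decide), zero_add, mul_zero, add_zero] at h'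
  have h1 : (X 1 : MvPolynomial (Fin 3) K) ∣ π p := by
    have : (X 1 : MvPolynomial (Fin 3) K) ∣ π p * X 2 * X 2 :=
      ⟨π p * X 1 - π x * X 2, by linear_combination -h'⟩
    rw [X_dvd_mul_iff, X_dvd_mul_iff] at this
    have hn := not_X_dvd_X (K := K) (show (1 : Fin 3) ≠ 2 by decide)
    tauto
  have h2 : (X 2 : MvPolynomial (Fin 3) K) ∣ π p := by
    have : (X 2 : MvPolynomial (Fin 3) K) ∣ π p * X 1 * X 1 :=
      ⟨π p * X 2 + π x * X 1, by linear_combination h'⟩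
    rw [X_dvd_mul_iff, X_dvd_mul_iff] at this
    have hn := not_X_dvd_X (K := K) (show (2 : Fin 3) ≠ 1 by decide)
    tauto
  obtain ⟨z, hz⟩ := h1
  rw [hz, X_dvd_mul_iff] at h2
  obtain ⟨z', hz'⟩ := h2.resolve_left (not_X_dvd_X (by decide))
  exact ⟨z', y', by linear_combination hy' + hz + X 1 * hz'⟩

/-- Passes from `(tu, s)` to `(tu, s²)`: write `p = α tu + β s`, cancel one factor `s`, and apply
the colon statement again to `β`. -/
lemma triangleQuadric_regular {p x y : MvPolynomial (Fin 3) K}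
    (h : p * triangleQuadric K = x * (X 1 * X 2) + y * (X 0 * X 0)) :
    ∃ x y, p = x * (X 1 * X 2) + y * (X 0 * X 0) := by
  obtain ⟨α, β, rfl⟩ := triangleQuadric_colon (p := p) (x := x) (y := y * X 0) (by linear_combination h)
  have hd : (X 0 : MvPolynomial (Fin 3) K) ∣ (x - α * triangleQuadric K) * X 1 * X 2 :=
    ⟨β * triangleQuadric K - y * X 0, by linear_combination -h⟩
  rw [X_dvd_mul_iff, X_dvd_mul_iff] at hd
  obtain ⟨z, hz⟩ := (hd.resolve_right (not_X_dvd_X (by decide))).resolve_right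
    (not_X_dvd_X (by decide))
  obtain ⟨x', y', rfl⟩ := triangleQuadric_colon (p := β) (x := z) (y := y) (by
    apply mul_right_cancel₀ (X_ne_zero (R := K) (0 : Fin 3))
    linear_combination h + X 1 * X 2 * hz)
  exact ⟨α + x' * X 0, y', by ring⟩

lemma X_mul_X_dvd_of_dvd_sq_mul {q p : MvPolynomial (Fin 3) K}
    (h : q * (X 0 * X 0) = p * (X 1 * X 2)) : X 1 * X 2 ∣ q := by
  have h1 : (X 1 : MvPolynomial (Fin 3) K) ∣ q * X 0 * X 0 :=
    ⟨p * X 2, by linear_combination h⟩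
  rw [X_dvd_mul_iff, X_dvd_mul_iff] at h1
  have hn := not_X_dvd_X (K := K) (show (1 : Fin 3) ≠ 0 by decide)
  obtain ⟨z, rfl⟩ : (X 1 : MvPolynomial (Fin 3) K) ∣ q := by tauto
  have h2 : (X 2 : MvPolynomial (Fin 3) K) ∣ z * X 0 * X 0 := by
    refine ⟨p, ?_⟩
    apply mul_right_cancel₀ (X_ne_zero (R := K) (1 : Fin 3))
    linear_combination h
  rw [X_dvd_mul_iff, X_dvd_mul_iff] at h2
  have hn := not_X_dvd_X (K := K) (show (2 : Fin 3) ≠ 0 by decide)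
  exact mul_dvd_mul_left _ (by tauto)

variable {V : Type*}

open Classical in
/-- The specialization of the variables at a triangle `a, b, c` which turns its binomials into a
complete intersection in three variables `s, t, u`. -/
noncomputable def triangleSpecialization (K : Type*) [Field K] {V : Type*} (a b c : V) :
    MvPolynomial (V ⊕ V) K →ₐ[K] MvPolynomial (Fin 3) K :=
  aeval (Sum.elim
    (fun i => if i = a then X 0 else if i = b then X 1 else if i = c then X 0 + X 1 else 0)
    (fun i => if i = a then X 1 else if i = b then X 0 + X 2 else
      if i = c then X 0 + X 2 else 0))

lemma parityBinomial_comm (i j : V) : parityBinomial K i j = parityBinomial K j i := by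
  simp only [parityBinomial]
  ring

/-- An edge with an endpoint outside the triangle specializes to zero, because both variables of
that endpoint do. -/
lemma triangleSpecialization_mem (G : SimpleGraph V) {a b c : V}
    {J : Ideal (MvPolynomial (Fin 3) K)}
    (h₁ : triangleSpecialization K a b c (parityBinomial K a b) ∈ J)
    (h₂ : triangleSpecialization K a b c (parityBinomial K a c) ∈ J)
    (h₃ : triangleSpecialization K a b c (parityBinomial K b c) ∈ J)
    {p : MvPolynomial (V ⊕ V) K} (hp : p ∈ parityBinomialEdgeIdeal K G) :
    triangleSpecialization K a b c p ∈ J := by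
  have hzero : ∀ i j : V, i ≠ a → i ≠ b → i ≠ c →
      triangleSpecialization K a b c (parityBinomial K i j) = 0 := by
    intro i j h1 h2 h3
    simp [triangleSpecialization, parityBinomial, h1, h2, h3]
  suffices h : parityBinomialEdgeIdeal K G ≤ Ideal.comap (triangleSpecialization K a b c) J from
    h hp
  rw [parityBinomialEdgeIdeal_eq_span, Ideal.span_le]
  rintro _ ⟨i, j, hij, rfl⟩
  rw [SetLike.mem_coe, Ideal.mem_comap]
  by_cases hi : i ≠ a ∧ i ≠ b ∧ i ≠ c
  · rw [hzero i j hi.1 hi.2.1 hi.2.2]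
    exact zero_mem _
  by_cases hj : j ≠ a ∧ j ≠ b ∧ j ≠ c
  · rw [parityBinomial_comm, hzero j i hj.1 hj.2.1 hj.2.2]
    exact zero_mem _
  have hi' : i = a ∨ i = b ∨ i = c := by tauto
  have hj' : j = a ∨ j = b ∨ j = c := by tauto
  have hij' := hij.ne
  have h₁' := h₁
  have h₂' := h₂
  have h₃' := h₃
  rw [parityBinomial_comm] at h₁' h₂' h₃'
  clear hi hj hij hzero hp
  generalize triangleSpecialization K a b c = ρ at *
  rcases hi' with hi' | hi' | hi' <;> rcases hj' with hj' | hj' | hj' <;> rw [hi', hj'] <;>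
    first
    | assumption
    | exact absurd (hi'.trans hj'.symm) hij'

/-- A triangle in `G` gives a third syzygy of degree six. -/
lemma exists_deg_three_eq_six (G : SimpleGraph V) {a b c : V} (hab : G.Adj a b)
    (hac : G.Adj a c) (hbc : G.Adj b c)
    (F : MinimalGradedFreeResolution (V ⊕ V) K (quotientComponent (parityBinomialEdgeIdeal K G))) :
    ∃ r, F.deg 3 r = 6 := by
  classical
  have hA := parityBinomials_subset_polyComponent (K := K) G
  have hI : parityBinomialEdgeIdeal K G ≠ ⊤ := by
    rw [Ne, Ideal.eq_top_iff_one]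
    intro h
    simpa using constantCoeff_eq_zero_of_mem_span hA (by norm_num) h
  have hmem : ∀ i j, G.Adj i j → parityBinomial K i j ∈ parityBinomialEdgeIdeal K G :=
    fun i j h => Ideal.subset_span ⟨i, j, h, rfl⟩
  set ρ := triangleSpecialization K a b c with hρdef
  -- The three images generate `(tu, s², t(s+t) - (s+u)²)`, a complete intersection in every
  -- characteristic.
  have hρ₁ : ρ (parityBinomial K a b) = -(X 1 * X 2) := by
    simp [hρdef, triangleSpecialization, parityBinomial, hab.ne.symm]
    ring
  have hρ₂ : ρ (parityBinomial K a c) = X 0 * X 0 - X 1 * X 2 := by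
    simp [hρdef, triangleSpecialization, parityBinomial, hac.ne.symm, hbc.ne.symm]
    ring
  have hρ₃ : ρ (parityBinomial K b c) = triangleQuadric K := by
    simp [hρdef, triangleSpecialization, parityBinomial, hac.ne.symm, hbc.ne.symm, hab.ne.symm,
      triangleQuadric]
  refine F.exists_deg_three_eq_six hI (ρ : MvPolynomial (V ⊕ V) K →+* MvPolynomial (Fin 3) K)
    (constantCoeff (R := K) (σ := Fin 3)) ?_ (hmem a b hab) (hmem a c hac) (hmem b c hbc)
    (parityBinomial_mem_polyComponent _ _) (parityBinomial_mem_polyComponent _ _)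
    (parityBinomial_mem_polyComponent _ _) ?_ ?_ ?_ ?_
  · intro p hp
    have hcomp : ((constantCoeff (R := K) (σ := Fin 3)).comp
        (ρ : MvPolynomial (V ⊕ V) K →+* MvPolynomial (Fin 3) K)) = constantCoeff := by
      apply MvPolynomial.ringHom_ext
      · intro r
        simp
      · rintro (i | i)
        · simp only [hρdef, triangleSpecialization, RingHom.comp_apply, RingHom.coe_coe, aeval_X,
            Sum.elim_inl, constantCoeff_X]
          split_ifs <;> simp
        · simp only [hρdef, triangleSpecialization, RingHom.comp_apply, RingHom.coe_coe, aeval_X,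
            Sum.elim_inr, constantCoeff_X]
          split_ifs <;> simp
    exact (RingHom.congr_fun hcomp p).trans hp
  · intro p hp
    have := triangleSpecialization_mem (a := a) (b := b) (c := c) (J := Ideal.span {ρ (parityBinomial K a b),
      ρ (parityBinomial K a c), ρ (parityBinomial K b c)}) G
      (Ideal.subset_span (by simp [hρdef])) (Ideal.subset_span (by simp [hρdef]))
      (Ideal.subset_span (by simp [hρdef])) hp
    rw [← hρdef, Ideal.mem_span_insert] at this
    obtain ⟨x, z, hz, hp⟩ := this
    obtain ⟨y, w, rfl⟩ := Ideal.mem_span_pair.1 hz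
    refine ⟨x, y, w, ?_⟩
    rw [add_assoc]
    exact hp
  · simp only [RingHom.coe_coe, hρ₁]
    exact neg_ne_zero.2 (mul_ne_zero (X_ne_zero _) (X_ne_zero _))
  · simp only [RingHom.coe_coe, hρ₁, hρ₂]
    intro p q h
    rw [neg_dvd]
    exact X_mul_X_dvd_of_dvd_sq_mul (p := p + q) (by linear_combination h)
  · simp only [RingHom.coe_coe, hρ₁, hρ₂, hρ₃]
    intro q x y h
    obtain ⟨x', y', rfl⟩ := triangleQuadric_regular (p := q) (x := -x - y) (y := y)
      (by linear_combination h)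
    exact ⟨-x' - y', y', by ring⟩

end TriangleSpecialization

/-! ### Graphs on four vertices and the conclusion -/

section MainResult

variable {K : Type*} [Field K] {V : Type*}

/-- A triangle `a, b, c` and a further neighbour `v` of `c` force syzygies of the degrees five and
six in the third step of the resolution. -/
lemma quotientBetti_three_ne_zero [Finite V] (G : SimpleGraph V) {a b c v : V} (hab : G.Adj a b)
    (hac : G.Adj a c) (hbc : G.Adj b c) (hcv : G.Adj c v) (hav : a ≠ v) (hbv : b ≠ v) :
    quotientBetti (parityBinomialEdgeIdeal K G) 3 5 ≠ 0 ∧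
      quotientBetti (parityBinomialEdgeIdeal K G) 3 6 ≠ 0 := by
  have hA := parityBinomials_subset_polyComponent (K := K) G
  have hne : Nonempty (MinimalGradedFreeResolution (V ⊕ V) K
      (quotientComponent (parityBinomialEdgeIdeal K G))) :=
    nonempty_minimalGradedFreeResolution (fun p hp j => polyPart_mem_span hA hp j)
      fun p hp => mem_idealOfVars_iff_constantCoeff.2
        (constantCoeff_eq_zero_of_mem_span hA (by norm_num) hp)
  simp only [quotientBetti, gradedBetti, dif_pos hne]
  rw [MinimalGradedFreeResolution.betti_ne_zero_iff,
    MinimalGradedFreeResolution.betti_ne_zero_iff]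
  exact ⟨exists_deg_three_eq_five G hac.symm hbc.symm hcv hab.ne hav hbv _,
    exists_deg_three_eq_six G hab hac hbc _⟩

lemma not_hasPureResolution_of_ne_zero {σ : Type*} {I : Ideal (MvPolynomial σ K)} {i : ℕ}
    (hi : 1 ≤ i) {j k : ℤ} (hj : 0 < j) (hk : 0 < k) (hjk : j ≠ k) (h1 : quotientBetti I i j ≠ 0)
    (h2 : quotientBetti I i k ≠ 0) : ¬ HasPureResolution I := by
  intro h
  have hle : (i : ℕ∞) ≤ quotientPd I := le_iSup₂_of_le i ⟨j, h1⟩ le_rfl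
  exact hjk ((h i hi hle).unique ⟨hj, h1⟩ ⟨hk, h2⟩)

/-- A graph on four vertices missing at most one edge contains a triangle with a pendant edge. -/
lemma exists_triangle_pendant_of_missing [Fintype V] (hV : Fintype.card V = 4) (G : SimpleGraph V)
    {p q : V} (hpq : p ≠ q) (h : ∀ i j, i ≠ j → s(i, j) ≠ s(p, q) → G.Adj i j) :
    ∃ a b c v, G.Adj a b ∧ G.Adj a c ∧ G.Adj b c ∧ G.Adj c v ∧ a ≠ v ∧ b ≠ v := by
  classical
  have hcard : ({p, q}ᶜ : Finset V).card = 2 := by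
    rw [Finset.card_compl, hV, Finset.card_pair hpq]
  obtain ⟨r, s, hrs, hset⟩ := Finset.card_eq_two.1 hcard
  have hr : r ∈ ({p, q}ᶜ : Finset V) := by simp [hset]
  have hs : s ∈ ({p, q}ᶜ : Finset V) := by simp [hset]
  simp only [Finset.mem_compl, Finset.mem_insert, Finset.mem_singleton, not_or] at hr hs
  -- With `r, s` the vertices off the possibly missing edge, the triangle is `s, q, r` and `p` hangs
  -- from `r`; none of these edges is `s(p, q)`.
  refine ⟨s, q, r, p, h _ _ hs.2 ?_, h _ _ hrs.symm ?_, h _ _ (Ne.symm hr.2) ?_, h _ _ hr.1 ?_, hs.1,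
    hpq.symm⟩ <;> simp [hs.1, hs.2, hr.1, hr.2, hpq.symm]

lemma exists_triangle_pendant [Fintype V] (hV : Fintype.card V = 4) (G : SimpleGraph V)
    (hG : IsDiamond G ∨ G = ⊤ ∨ IsTriangleWithPendantEdge G) :
    ∃ a b c v, G.Adj a b ∧ G.Adj a c ∧ G.Adj b c ∧ G.Adj c v ∧ a ≠ v ∧ b ≠ v := by
  classical
  rcases hG with ⟨-, hG⟩ | rfl | ⟨a, b, c, v, hnd, -, hG⟩
  · have htop : (⊤ : SimpleGraph V).edgeSet.ncard = 6 := by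
      rw [← SimpleGraph.coe_edgeFinset, Set.ncard_coe_finset,
        SimpleGraph.card_edgeFinset_top_eq_card_choose_two, hV]
      rfl
    have hdiff : ((⊤ : SimpleGraph V).edgeSet \ G.edgeSet).ncard = 1 := by
      rw [Set.ncard_sdiff (SimpleGraph.edgeSet_mono le_top) (Set.toFinite _), htop, hG]
    obtain ⟨e, he⟩ := Set.ncard_eq_one.1 hdiff
    induction e using Sym2.ind with
    | _ p q =>
      have hpq : s(p, q) ∈ (⊤ : SimpleGraph V).edgeSet \ G.edgeSet := he ▸ Set.mem_singleton _
      have hne : p ≠ q := by simpa using hpq.1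
      refine exists_triangle_pendant_of_missing hV G hne fun i j hij hs => ?_
      by_contra hadj
      have hmem : s(i, j) ∈ (⊤ : SimpleGraph V).edgeSet \ G.edgeSet :=
        ⟨by simpa using hij, by simpa using hadj⟩
      rw [he] at hmem
      exact hs hmem
  · have : Nontrivial V := Fintype.one_lt_card_iff_nontrivial.1 (by omega)
    obtain ⟨p, q, hpq⟩ := exists_pair_ne V
    exact exists_triangle_pendant_of_missing hV ⊤ hpq fun i j hij _ => hij
  · simp only [List.nodup_cons, List.mem_cons, List.not_mem_nil, or_false, not_or] at hnd
    refine ⟨a, b, c, v, ?_, ?_, ?_, ?_, hnd.1.2.2, hnd.2.1.2⟩ <;>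
      rw [← SimpleGraph.mem_edgeSet, hG] <;> simp

end MainResult

theorem proposition3p10 (K : Type*) [Field K] {V : Type*} [Fintype V] (hV : Fintype.card V = 4)
    (G : SimpleGraph V) (hG : IsDiamond G ∨ G = ⊤ ∨ IsTriangleWithPendantEdge G) :
    ¬ HasPureResolution (parityBinomialEdgeIdeal K G) ∧
    quotientBetti (parityBinomialEdgeIdeal K G) 3 5 ≠ 0 ∧
    quotientBetti (parityBinomialEdgeIdeal K G) 3 6 ≠ 0 := by
  obtain ⟨a, b, c, v, hab, hac, hbc, hcv, hav, hbv⟩ := exists_triangle_pendant hV G hG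
  obtain ⟨h5, h6⟩ := quotientBetti_three_ne_zero (K := K) G hab hac hbc hcv hav hbv
  exact ⟨not_hasPureResolution_of_ne_zero (by norm_num) (by norm_num) (by norm_num) (by norm_num)
    h5 h6, h5, h6⟩
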